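/- Let $F$ be a field of characteristic not $2$, with algebraic closure $\overline F$. A field extension $L/F$ is *biquadratic* if $L=F(x)$ for some $x$ whose minimal polynomial over $F$ is $X^4+uX^2+w$ with $u,w\in F$. It is *cyclic* (respectively *elementary abelian*) if it is Galois with group $\mathbb Z/4$ (respectively $\mathbb Z/2\times\mathbb Z/2$). Let $S\subset F^\times$ be a complete set of representatives of the non-trivial classes of $G:=F^\times/(F^\times)^2$. For $s\in S$ put $E_s=F(\sqrt s)\subset\overline F$, let $\sigma$ be the generator of $\mathrm{Gal}(E_s/F)\cong S_2$, and let $N_{E_s}=\{\alpha\in E_s^\times : \alpha\sigma(\alpha)\in (E_s^\times)^2\}$, a union of cosets of $(E_s^\times)^2$ that is stable under $\sigma$. Let $S_3$ act on $G\times G$ by permuting the triples $(b,b',bb')$. Let $N=\{(1,a): a\in G\}$, a subgroup of $G\times G$ isomorphic to $G$, and let $\bigl((G\times G)-N\bigr)/S_3$ denote the set of $S_3$-orbits in $G\times G$ that do not meet $N$. **(1)** There is a bijection $$\psi:\{\text{non-cyclic biquadratic extensions of }F\}/\!\cong_F\ \longrightarrow\ \Bigl(\coprod_{s\in S}\bigl((E_s^\times-N_{E_s})/(E_s^\times)^2\bigr)/S_2\Bigr)\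 \amalg\ \bigl((G\times G)-N\bigr)/S_3$$ under which the non-Galois extensions correspond to the first part and the elementary abelian extensions to the second part. If $L$ has a generator with minimal polynomial $X^4-aX^2+\tfrac14b^2s$, where $s\in S$ and $a,b\in F$, then $\psi([L])$ is the class of $a+b\sqrt s$ in the component of $s$. If $L$ has a generator with minimal polynomial $X^4-2(a+b)X^2+(a-b)^2$, where $a,b\in F^\times$, then $\psi([L])$ is the orbit of the pair of classes of $a$ and $b$. **(2)** Let $C\subset\overline F$ be the compositum of all quadratic extensions of $F$. Let $\sim_{Q^2}$ be the equivalence relation on $C^\times\times C^\times$ for which $(a,a')\sim_{Q^2}(b,b')$ if and only if one of the following holds: $(a,a')=(b,b')$; or $a,a',b,b'\in F^\times$ and $a/b,\ a'/b'\in(F^\times)^2$; or there is $\delta\in C$ with $\delta^2\in F^\times$ such that $a,b\in F(\delta)^\times-F^\times$, $a'=\tau(a)$ and $b'=\tau(b)$, where $\mathrm{Gal}(F(\delta)/F)=\langle\tau\rangle$, and $a/b\in(F(\delta)^\times)^2$. Let $\bigl((C^\times\times C^\times)/{\sim_{Q^2}}\bigr)/S_3$ be the quotient of $(C^\times\times C^\times)/{\sim_{Q^2}}$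 by the equivalence relation generated by identifying the class of $(b,b')$ with the class of $(c,d)$ whenever $c,d$ are the first two entries of a permutation of the triple $(b,b',bb')$. Then the right-hand side of (1) embeds into this quotient by the injective map that sends the class of $\alpha\in E_s^\times-N_{E_s}$ to the class of $(\alpha,\sigma(\alpha))$, and the orbit of the classes of $(a,b)\in F^\times\times F^\times$ to the class of $(a,b)$. -/

import Mathlib

open Polynomial IntermediateField

universe u v

namespace Biquad

section Extensions

variable (F : Type u) [Field F] (L : Type v) [Field L] [Algebra F L]

/-- `x` generates `L/F` and has minimal polynomial `X ^ 4 + c X ^ 2 + d` over `F`. -/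
def IsGenWithMinpoly (x : L) (c d : F) : Prop :=
  F⟮x⟯ = ⊤ ∧ minpoly F x = X ^ 4 + C c * X ^ 2 + C d

/-- A quartic extension with a primitive element whose minimal polynomial is
`X ^ 4 + c X ^ 2 + d`. -/
def IsBiquadratic : Prop :=
  ∃ (x : L) (c d : F), IsGenWithMinpoly F L x c d

/-- Galois with group cyclic of order four. -/
def IsCyclicQuartic : Prop :=
  IsGalois F L ∧ Nonempty ((L ≃ₐ[F] L) ≃* Multiplicative (ZMod 4))

/-- Galois with group the product of two cyclic groups of order two. -/
def IsElementaryAbelianQuartic : Prop :=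
  IsGalois F L ∧ Nonempty ((L ≃ₐ[F] L) ≃* Multiplicative (ZMod 2 × ZMod 2))

end Extensions

/-- A non-cyclic biquadratic extension of `F`. -/
structure NonCyclicExt (F : Type u) [Field F] where
  carrier : Type u
  [field : Field carrier]
  [algebra : Algebra F carrier]
  biquadratic : IsBiquadratic F carrier
  not_cyclic : ¬ IsCyclicQuartic F carrier

attribute [instance] NonCyclicExt.field NonCyclicExt.algebra

/-- `F`-isomorphism of non-cyclic biquadratic extensions. -/
instance isoSetoid (F : Type u) [Field F] : Setoid (NonCyclicExt F) where
  r L L' := Nonempty (L.carrier ≃ₐ[F] L'.carrier)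
  iseqv :=
    { refl := fun _ => ⟨AlgEquiv.refl⟩
      symm := fun ⟨e⟩ => ⟨e.symm⟩
      trans := fun ⟨e⟩ ⟨e'⟩ => ⟨e.trans e'⟩ }

/-- Isomorphism classes of non-cyclic biquadratic extensions of `F`. -/
abbrev IsoClasses (F : Type u) [Field F] : Type (u + 1) := Quotient (isoSetoid F)

section SquareClasses

/-- The square class group of a field. -/
abbrev SqClass (K : Type u) [Field K] : Type u :=
  Kˣ ⧸ (powMonoidHom 2 : Kˣ →* Kˣ).range

/-- The square class of a non-zero element. -/
abbrev sq {K : Type u} [Field K] (a : Kˣ) : SqClass K := QuotientGroup.mk a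

theorem SqClass.mul_self {K : Type u} [Field K] (x : SqClass K) : x * x = 1 := by
  induction x using QuotientGroup.induction_on with
  | H a =>
    rw [← QuotientGroup.mk_mul, QuotientGroup.eq_one_iff]
    exact ⟨a, pow_two a⟩

/-- The map on square classes induced by a ring endomorphism. -/
def SqClass.map {K : Type u} [Field K] (f : K →+* K) : SqClass K →* SqClass K :=
  QuotientGroup.map _ _ (Units.map (f : K →* K)) (by
    rintro _ ⟨b, rfl⟩
    exact ⟨Units.map (f : K →* K) b, by simp⟩)

@[simp] theorem SqClass.map_sq {K : Type u} [Field K] (f : K →+* K) (a : Kˣ) :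
    SqClass.map f (sq a) = sq (Units.map (f : K →* K) a) := rfl

/-- The Galois action on square classes. -/
instance galAction (F : Type v) [Field F] (E : Type u) [Field E] [Algebra F E] :
    MulAction (E ≃ₐ[F] E) (SqClass E) where
  smul τ x := SqClass.map (τ : E →+* E) x
  one_smul x := by
    induction x using QuotientGroup.induction_on with
    | H a => exact congrArg sq (Units.ext rfl)
  mul_smul τ τ' x := by
    induction x using QuotientGroup.induction_on with
    | H a => exact congrArg sq (Units.ext rfl)

end SquareClasses

section Triples

/-- The triple `(b, b', b b')` attached to a pair `(b, b')`. -/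
def triple {M : Type u} [Mul M] (p : M × M) : Fin 3 → M := ![p.1, p.2, p.1 * p.2]

/-- The first two entries of the triple `(b, b', b b')` permuted by `τ`. -/
def permPair {M : Type u} [Mul M] (τ : Equiv.Perm (Fin 3)) (p : M × M) : M × M :=
  (triple p (τ 0), triple p (τ 1))

theorem triple_prod {K : Type u} [Field K] (p : SqClass K × SqClass K) :
    ∏ i, triple p i = 1 := by
  rw [Fin.prod_univ_three]
  exact SqClass.mul_self (p.1 * p.2)

theorem triple_permPair {K : Type u} [Field K] (τ : Equiv.Perm (Fin 3))
    (p : SqClass K × SqClass K) (i : Fin 3) :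
    triple (permPair τ p) i = triple p (τ i) := by
  have h : triple p (τ 0) * triple p (τ 1) * triple p (τ 2) = 1 := by
    rw [← Fin.prod_univ_three (fun i => triple p (τ i)), Equiv.prod_comp τ (triple p),
      triple_prod]
  fin_cases i
  · rfl
  · rfl
  · change triple p (τ 0) * triple p (τ 1) = triple p (τ 2)
    rw [eq_comm, ← mul_one (triple p (τ 2)), ← SqClass.mul_self (triple p (τ 0) * triple p (τ 1)),
      ← mul_assoc, mul_comm (triple p (τ 2)), h]
    exact one_mul (triple p (τ 0) * triple p (τ 1))

/-- The action of `S₃` on pairs of square classes which permutes the triple `(b, b', b b')`.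
The inverse makes it a left action; it does not change the orbits. -/
instance s3Action (F : Type u) [Field F] :
    MulAction (Equiv.Perm (Fin 3)) (SqClass F × SqClass F) where
  smul τ p := permPair τ⁻¹ p
  one_smul _ := rfl
  mul_smul τ τ' p := by
    change permPair (τ * τ')⁻¹ p = permPair τ⁻¹ (permPair τ'⁻¹ p)
    refine Prod.ext ?_ ?_
    · change _ = triple (permPair τ'⁻¹ p) (τ⁻¹ 0)
      rw [triple_permPair, mul_inv_rev]; rfl
    · change _ = triple (permPair τ'⁻¹ p) (τ⁻¹ 1)
      rw [triple_permPair, mul_inv_rev]; rfl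

end Triples

section ElementaryAbelian

variable (F : Type u) [Field F]

/-- The subgroup of all pairs `(1, a)` of square classes. -/
def trivialPairs : Subgroup (SqClass F × SqClass F) := Subgroup.prod ⊥ ⊤

/-- The orbits of `S₃` on pairs of square classes that do not meet `trivialPairs F`. -/
abbrev ElemParam : Type u :=
  {o : MulAction.orbitRel.Quotient (Equiv.Perm (Fin 3)) (SqClass F × SqClass F) //
    ∀ p ∈ trivialPairs F, o ≠ Quotient.mk _ p}

/-- The `S₃`-orbit of the pair of square classes of `(a, b)`. -/
def elemOrbit {F : Type u} [Field F] (a b : Fˣ) :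
    MulAction.orbitRel.Quotient (Equiv.Perm (Fin 3)) (SqClass F × SqClass F) :=
  Quotient.mk _ (sq a, sq b)

end ElementaryAbelian

section NonGalois

variable (F : Type u) [Field F] (E : Type v) [Field E] [Algebra F E]

/-- The elements `α` of `Eˣ` such that `α σ(α)` is a square in `Eˣ`, where `σ` generates the
Galois group of `E/F`. -/
def normSquare : Set Eˣ :=
  {α | ∃ σ : E ≃ₐ[F] E, Subgroup.zpowers σ = ⊤ ∧
    IsSquare (α * Units.map (σ : E →* E) α)}

/-- The Galois orbits of square classes of elements of `Eˣ` outside `normSquare F E`. -/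
abbrev NonGaloisParam : Type v :=
  {o : MulAction.orbitRel.Quotient (E ≃ₐ[F] E) (SqClass E) //
    ∃ α : Eˣ, α ∉ normSquare F E ∧ o = Quotient.mk _ (sq α)}

/-- The Galois orbit of the square class of `α`. -/
def galOrbit {E : Type v} [Field E] [Algebra F E] (α : Eˣ) :
    MulAction.orbitRel.Quotient (E ≃ₐ[F] E) (SqClass E) :=
  Quotient.mk _ (sq α)

end NonGalois

section Compositum

variable {F : Type u} [Field F] (Ω : Type v) [Field Ω] [Algebra F Ω]

/-- The subfield `F(√s)` of `Ω`. -/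
def sqrtField (s : Fˣ) : IntermediateField F Ω :=
  IntermediateField.adjoin F {x : Ω | x ^ 2 = algebraMap F Ω s}

variable (F) in
/-- The compositum in `Ω` of all quadratic extensions of `F`. -/
def quadCompositum : IntermediateField F Ω :=
  ⨆ (K : IntermediateField F Ω) (_ : Module.finrank F K = 2), K

/-- `S` is a complete set of representatives of the non-trivial square classes of `F`. -/
def IsRepSet (S : Set Fˣ) : Prop := Set.BijOn (fun s : Fˣ => sq s) S {1}ᶜ

/-- The disjoint union of the two parameter sets. -/
abbrev Param (S : Set Fˣ) : Type (max u v) :=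
  (Σ s : S, NonGaloisParam F (sqrtField Ω s.1)) ⊕ ElemParam F

end Compositum

section Q2

variable (F : Type u) [Field F] (C : Type v) [Field C] [Algebra F C]

/-- The relation on `Cˣ × Cˣ`: equality; or all entries lie in `Fˣ` and agree modulo
squares of `Fˣ`; or the pairs are `(a, σ a)` and `(b, σ b)` with `a` and `b` in
`F(δ)ˣ` but not in `F`, where `δ ^ 2 ∈ Fˣ` and `σ` generates the Galois group of `F(δ)/F`, and
`a / b` is a square in `F(δ)ˣ`. -/
def Q2Rel (x y : Cˣ × Cˣ) : Prop :=
  x = y ∨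
  (∃ a a' b b' : Fˣ,
    x = (Units.map (algebraMap F C : F →* C) a, Units.map (algebraMap F C : F →* C) a') ∧
    y = (Units.map (algebraMap F C : F →* C) b, Units.map (algebraMap F C : F →* C) b') ∧
    IsSquare (a / b) ∧ IsSquare (a' / b')) ∨
  (∃ (δ : C) (d : Fˣ), δ ^ 2 = algebraMap F C d ∧
    ∃ σ : F⟮δ⟯ ≃ₐ[F] F⟮δ⟯, Subgroup.zpowers σ = ⊤ ∧
    ∃ a b : (F⟮δ⟯)ˣ,
      (a : F⟮δ⟯) ∉ (algebraMap F F⟮δ⟯).range ∧ (b : F⟮δ⟯) ∉ (algebraMap F F⟮δ⟯).range ∧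
      (x.1 : C) = (a : F⟮δ⟯) ∧ (x.2 : C) = σ a ∧
      (y.1 : C) = (b : F⟮δ⟯) ∧ (y.2 : C) = σ b ∧
      IsSquare (a / b))

theorem finrank_adjoin_le {F : Type u} [Field F] {C : Type v} [Field C] [Algebra F C]
    {δ : C} {d : F} (h : δ ^ 2 = algebraMap F C d) :
    FiniteDimensional F F⟮δ⟯ ∧ Module.finrank F F⟮δ⟯ ≤ 2 := by
  have hm : (X ^ 2 - Polynomial.C d : F[X]).Monic := monic_X_pow_sub_C d two_ne_zero
  have h0 : aeval δ (X ^ 2 - Polynomial.C d : F[X]) = 0 := by simp [h]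
  have hi : IsIntegral F δ := ⟨_, hm, h0⟩
  refine ⟨adjoin.finiteDimensional hi, ?_⟩
  rw [adjoin.finrank hi, ← natDegree_X_pow_sub_C (n := 2) (r := d)]
  exact natDegree_le_of_dvd (minpoly.dvd F δ h0) hm.ne_zero

theorem adjoin_eq_of_notMem {F : Type u} [Field F] {C : Type v} [Field C] [Algebra F C]
    {δ : C} {d : F} (h : δ ^ 2 = algebraMap F C d) (a : F⟮δ⟯)
    (ha : a ∉ (algebraMap F F⟮δ⟯).range) : F⟮δ⟯ = F⟮(a : C)⟯ := by
  obtain ⟨hf, hr⟩ := finrank_adjoin_le h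
  symm
  have hle : F⟮(a : C)⟯ ≤ F⟮δ⟯ := by simp
  refine eq_of_le_of_finrank_le hle (hr.trans ?_)
  have : FiniteDimensional F F⟮(a : C)⟯ :=
    Module.Finite.of_injective (inclusion hle).toLinearMap (inclusion hle).injective
  have h1 : Module.finrank F F⟮(a : C)⟯ ≠ 1 := by
    rw [Ne, finrank_adjoin_simple_eq_one_iff]
    rintro hb
    obtain ⟨c, hc⟩ := mem_bot.1 hb
    exact ha ⟨c, Subtype.ext hc⟩
  have h2 : 0 < Module.finrank F F⟮(a : C)⟯ := Module.finrank_pos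
  omega

theorem q2Rel_equivalence : Equivalence (Q2Rel F C) where
  refl _ := Or.inl rfl
  symm := by
    rintro x y (h | ⟨a, a', b, b', hx, hy, h, h'⟩ | ⟨δ, d, hd, σ, hσ, a, b, ha, hb, h1, h2, h3, h4, h⟩)
    · exact Or.inl h.symm
    · refine Or.inr (Or.inl ⟨b, b', a, a', hy, hx, ?_, ?_⟩)
      · simpa using h.inv
      · simpa using h'.inv
    · refine Or.inr (Or.inr ⟨δ, d, hd, σ, hσ, b, a, hb, ha, h3, h4, h1, h2, ?_⟩)
      simpa using h.inv
  trans := by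
    have key : ∀ (x y : Cˣ × Cˣ) (c : Fˣ) (δ : C) (a : F⟮δ⟯),
        a ∉ (algebraMap F F⟮δ⟯).range → (x.1 : C) = a → x.1 ≠ Units.map (algebraMap F C : F →* C) c := by
      intro x y c δ a ha h h'
      refine ha ⟨c, Subtype.ext ?_⟩
      rw [← h, h']
      rfl
    rintro x y z (rfl | ⟨a, a', b, b', hx, hy, h, h'⟩ | ⟨δ, d, hd, σ, hσ, a, b, ha, hb, h1, h2, h3, h4, h⟩)
      hyz
    · exact hyz
    · rcases hyz with (rfl | ⟨e, e', f, f', hx', hy', g, g'⟩ |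
        ⟨δ, d, hd, σ, hσ, e, f, he, hf, h1, h2, h3, h4, h⟩)
      · exact Or.inr (Or.inl ⟨a, a', b, b', hx, hy, h, h'⟩)
      · have hinj : Function.Injective (Units.map (algebraMap F C : F →* C)) :=
          Units.map_injective (algebraMap F C).injective
        rw [hy, Prod.ext_iff] at hx'
        obtain rfl := hinj hx'.1
        obtain rfl := hinj hx'.2
        refine Or.inr (Or.inl ⟨a, a', f, f', hx, hy', ?_, ?_⟩)
        · simpa using h.mul g
        · simpa using h'.mul g'
      · exact absurd (congrArg Prod.fst hy) (key y y b δ e he h1)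
    · rcases hyz with (rfl | ⟨e, e', f, f', hx', hy', g, g'⟩ |
        ⟨δ', d', hd', σ', hσ', b₁, c, hb₁, hc, h1', h2', h3', h4', h'⟩)
      · exact Or.inr (Or.inr ⟨δ, d, hd, σ, hσ, a, b, ha, hb, h1, h2, h3, h4, h⟩)
      · exact absurd (congrArg Prod.fst hx') (key y y e δ b hb h3)
      · have e1 := adjoin_eq_of_notMem hd (b : F⟮δ⟯) hb
        have e2 := adjoin_eq_of_notMem hd' (b₁ : F⟮δ'⟯) hb₁
        rw [← h3] at e1
        rw [← h1'] at e2
        have e3 : F⟮δ'⟯ = F⟮δ⟯ := e2.trans e1.symm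
        refine Or.inr (Or.inr ⟨δ, d, hd, σ, hσ, a, ?_⟩)
        generalize F⟮δ'⟯ = K at *
        subst e3
        have hbb : b₁ = b := Units.ext (Subtype.ext (h1'.symm.trans h3))
        subst hbb
        have hs : (σ' : F⟮δ⟯ →ₐ[F] F⟮δ⟯) = σ := by
          refine algHom_ext_of_eq_adjoin F e1 ?_
          rintro w rfl
          have : (σ' (b₁ : F⟮δ⟯)) = σ b₁ := Subtype.ext (h2'.symm.trans h4)
          have hb' : ∀ h, (⟨(y.1 : C), h⟩ : F⟮δ⟯) = b₁ := fun _ => Subtype.ext h3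
          change σ' ⟨_, _⟩ = σ ⟨_, _⟩
          rw [hb', this]
        have hs' : ∀ w, σ' w = σ w := fun w => DFunLike.congr_fun hs w
        refine ⟨c, ha, hc, h1, h2, h3', ?_, ?_⟩
        · rw [h4', hs']
        · simpa using h.mul h'

/-- The relation above as a setoid. -/
def q2Setoid : Setoid (Cˣ × Cˣ) := ⟨Q2Rel F C, q2Rel_equivalence F C⟩

/-- The quotient of `Cˣ × Cˣ` by `Q2Rel F C`. -/
abbrev Q2Quot : Type v := Quotient (q2Setoid F C)

/-- Two elements of the quotient are related if a pair `(b, b')` representing the first and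
some permutation `τ` of the triple `(b, b', b b')` give a pair, formed by the first two entries of
the permuted triple, that represents the second. -/
def S3Rel (x y : Q2Quot F C) : Prop :=
  ∃ (τ : Equiv.Perm (Fin 3)) (p : Cˣ × Cˣ),
    x = Quotient.mk (q2Setoid F C) p ∧ y = Quotient.mk (q2Setoid F C) (permPair τ p)

/-- The quotient of `Q2Quot F C` by the equivalence relation that `S3Rel F C` generates. For pairs
of square classes the analogous quotient is the orbit space of `S₃`; here permuting the triple
`(b, b', b b')` does not give a group action, so the generated relation takes its place. -/
abbrev Q2S3Quot : Type v := Quot (S3Rel F C)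

/-- The class of the pair `(a, b)`. -/
def q2Class {C : Type v} [Field C] [Algebra F C] (a b : Cˣ) : Q2S3Quot F C :=
  Quot.mk _ (Quotient.mk (q2Setoid F C) (a, b))

end Q2

end Biquad

/-!
Everything is governed by a generator `x` with minimal polynomial `X ^ 4 + c X ^ 2 + d`. Put
`D = c ^ 2 - 4 d` and `w = 2 x ^ 2 + c`, so that `w ^ 2 = D` and `1, w, x, w x` is a basis of `L`.
The extension is Galois if and only if `d` or `d D` is a square (`IsGenWithMinpoly.isGalois_iff`); in
the first case the group is the Klein four-group, in the second it is cyclic. Hence a non-cyclic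
extension is elementary abelian if `d` is a square and non-Galois otherwise.

If `d` is a square, then `L = F(√a, √b)` with `x = √a + √b`, and the square classes of `F` that
become trivial in `L` are those of `1, a, b, a b` (`IsGenWithMinpoly.isSquare_of_sq_eq`). So the
orbit of the pair of classes of `a` and `b` and the extension determine each other.

If `d` is not a square, write `c = - a` and `d = b ^ 2 s / 4`. For two roots `x, x'` of the
quartic with `2 x x' = b √s` one has `(x + x') ^ 2 = a + b √s`, and this is the element `α`
attached to `L`; that `L` be a field of degree four and not cyclic says precisely that
`α σ(α) = D` is not a square in `F(√s)`. As `F(w)` is the only quadratic subfield of `L`, every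
other generator with an even minimal polynomial is `(p + q w) x` with `p, q` in `F`
(`IsGenWithMinpoly.exists_eq_mul`), and this change of generator multiplies `α` by
`(p + q σ(α)) ^ 2`, up to conjugation (`IsQuadraticGen.galOrbit_eq_of_gen`). Since `1` and `σ(α)`
form a basis of `F(√s)`, all elements of the square class of `α` arise in this way.

For the embedding, the `S₃`-orbit of the square classes over an intermediate field `K` of a pair
of elements of `K` is an invariant of the class of that pair in the final quotient
(`descentOrbits`). With `K = F` it separates pairs over `F` from each other and from the pairs
`(α, σ(α))`. With `K = F(√s)` it recovers the orbit of `(α, σ(α))`, and thereby `α` up to squares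
and conjugation, because `α σ(α)` is the only one of the classes of `α, σ(α), α σ(α)` that `σ`
fixes.
-/

universe w

namespace Biquad

/-! ### Square classes and the action of `S₃` on pairs of them -/

theorem sq_eq_one_iff {K : Type u} [Field K] {a : Kˣ} : sq a = 1 ↔ IsSquare (a : K) := by
  refine (QuotientGroup.eq_one_iff a).trans ⟨?_, ?_⟩
  · rintro ⟨b, rfl⟩
    exact ⟨b, by simp [pow_two]⟩
  · rintro ⟨b, hb⟩
    have h0 : b ≠ 0 := by
      rintro rfl
      simp at hb
    exact ⟨Units.mk0 b h0, Units.ext (by simp [hb, pow_two])⟩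

theorem SqClass.eq_of_mul_eq_one {K : Type u} [Field K] {x y : SqClass K} (h : x * y = 1) :
    x = y := by
  rw [← mul_one x, ← SqClass.mul_self y, ← mul_assoc, h]
  exact one_mul y

theorem sq_eq_sq_iff {K : Type u} [Field K] {a b : Kˣ} :
    sq a = sq b ↔ ∃ e : K, (a : K) = b * e ^ 2 := by
  constructor
  · intro h
    have h1 : sq (a / b) = 1 := by
      change sq a / sq b = 1
      rw [h, div_self']
    obtain ⟨e, he⟩ := sq_eq_one_iff.1 h1
    refine ⟨e, ?_⟩
    rw [pow_two, ← he, Units.val_div_eq_div_val]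
    field_simp
  · rintro ⟨e, he⟩
    apply SqClass.eq_of_mul_eq_one
    change sq (a * b) = 1
    exact sq_eq_one_iff.2 ⟨b * e, by rw [Units.val_mul, he]; ring⟩

theorem orbit_eq_iff {F : Type u} [Field F] {p q : SqClass F × SqClass F} :
    (Quotient.mk _ p : MulAction.orbitRel.Quotient (Equiv.Perm (Fin 3)) (SqClass F × SqClass F)) =
      Quotient.mk _ q ↔ ∃ τ, permPair τ q = p := by
  rw [Quotient.eq, MulAction.orbitRel_apply, MulAction.mem_orbit_iff]
  constructor
  · rintro ⟨τ, h⟩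
    exact ⟨τ⁻¹, h⟩
  · rintro ⟨τ, h⟩
    exact ⟨τ⁻¹, by rw [← h]; change permPair τ⁻¹⁻¹ q = _; rw [inv_inv]⟩

theorem exists_perm_of_ne {i j : Fin 3} (h : i ≠ j) :
    ∃ τ : Equiv.Perm (Fin 3), τ 0 = i ∧ τ 1 = j := by
  revert i j
  decide

theorem exists_triple_eq_of_orbit_eq {F : Type u} [Field F] {p q : SqClass F × SqClass F}
    (h : (Quotient.mk _ p : MulAction.orbitRel.Quotient (Equiv.Perm (Fin 3))
      (SqClass F × SqClass F)) = Quotient.mk _ q) (i : Fin 3) : ∃ j, triple p i = triple q j := by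
  obtain ⟨τ, rfl⟩ := orbit_eq_iff.1 h
  exact ⟨τ i, triple_permPair τ q i⟩

/-- Two distinct entries of a triple `(b, b', b b')` determine its orbit. -/
theorem orbit_eq_of_triple {F : Type u} [Field F] {p q : SqClass F × SqClass F}
    (hp : p.1 ≠ p.2) (h1 : ∃ i, p.1 = triple q i) (h2 : ∃ j, p.2 = triple q j) :
    (Quotient.mk _ p : MulAction.orbitRel.Quotient (Equiv.Perm (Fin 3))
      (SqClass F × SqClass F)) = Quotient.mk _ q := by
  obtain ⟨i, hi⟩ := h1
  obtain ⟨j, hj⟩ := h2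
  obtain ⟨τ, h0, h1⟩ := exists_perm_of_ne (i := i) (j := j) (fun h => hp (by rw [hi, hj, h]))
  refine orbit_eq_iff.2 ⟨τ, ?_⟩
  rw [permPair, h0, h1, ← hi, ← hj]

/-- An orbit avoids all pairs `(1, c)` if and only if no entry of its triple is trivial. -/
theorem orbit_avoids_iff {F : Type u} [Field F] {p : SqClass F × SqClass F} :
    (∀ r ∈ trivialPairs F, (Quotient.mk _ p : MulAction.orbitRel.Quotient (Equiv.Perm (Fin 3))
      (SqClass F × SqClass F)) ≠ Quotient.mk _ r) ↔ ∀ i, triple p i ≠ 1 := by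
  constructor
  · intro h i hi
    obtain ⟨j, hj⟩ : ∃ j, i ≠ j := ⟨i + 1, by clear hi; revert i; decide⟩
    obtain ⟨τ, h0, h1⟩ := exists_perm_of_ne hj
    refine h (permPair τ p) ?_ (orbit_eq_iff.2 ⟨τ, rfl⟩).symm
    refine ⟨?_, trivial⟩
    change triple p (τ 0) = 1
    rw [h0, hi]
  · rintro h r ⟨hr, -⟩ hpr
    obtain ⟨j, hj⟩ := exists_triple_eq_of_orbit_eq hpr.symm 0
    exact h j (hj.symm.trans hr)

/-- The isomorphism between the group of pairs `(1, a)` and the square class group. -/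
def trivialPairsEquiv (F : Type u) [Field F] : trivialPairs F ≃* SqClass F where
  toFun p := p.1.2
  invFun a := ⟨(1, a), rfl, trivial⟩
  left_inv := by
    rintro ⟨⟨x, a⟩, hx, -⟩
    obtain rfl : x = 1 := hx
    rfl
  right_inv _ := rfl
  map_mul' _ _ := rfl

/-! ### Even quartic polynomials and their root fields -/

section Quartic

variable {F : Type u} [Field F]

theorem monic_evenQuartic (c d : F) : (X ^ 4 + C c * X ^ 2 + C d : F[X]).Monic := by
  monicity!

theorem natDegree_evenQuartic (c d : F) : (X ^ 4 + C c * X ^ 2 + C d : F[X]).natDegree = 4 := by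
  compute_degree!

/-- If the discriminant `c ^ 2 - 4 d` in `X ^ 2` is not a square, and the polynomial is not a
product `(X ^ 2 + p X + q) (X ^ 2 - p X + q)`, then `X ^ 4 + c X ^ 2 + d` is irreducible. -/
theorem irreducible_evenQuartic {c d : F} (hD : ¬ IsSquare (c ^ 2 - 4 * d))
    (hd : ∀ q, q ^ 2 = d → ¬ IsSquare (2 * q - c)) :
    Irreducible (X ^ 4 + C c * X ^ 2 + C d : F[X]) := by
  have hroot : ∀ t : F, t ^ 4 + c * t ^ 2 + d ≠ 0 := by
    intro t ht
    exact hD ⟨2 * t ^ 2 + c, by linear_combination (-4) * ht⟩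
  rw [(monic_evenQuartic c d).irreducible_iff_natDegree']
  refine ⟨fun h => ?_, fun f g hf hg hfg hdeg => ?_⟩
  · have := natDegree_evenQuartic c d
    rw [h] at this
    simp at this
  rw [natDegree_evenQuartic, Finset.mem_Ioc] at hdeg
  have hsum : f.natDegree + g.natDegree = 4 := by
    rw [← natDegree_evenQuartic c d, ← hfg, hf.natDegree_mul hg]
  have hg12 : g.natDegree = 1 ∨ g.natDegree = 2 := by omega
  rcases hg12 with hg1 | hg2
  · have hg' : g = X + C (g.coeff 0) := by
      have := hg.as_sum
      rw [hg1] at this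
      simpa using this
    refine hroot (-g.coeff 0) ?_
    have h0 : (X ^ 4 + C c * X ^ 2 + C d : F[X]).eval (-g.coeff 0) = 0 := by
      rw [← hfg, eval_mul, hg']
      simp
    simpa using h0
  · have hf2 : f.natDegree = 2 := by omega
    have hg' : g = X ^ 2 + (C (g.coeff 0) + C (g.coeff 1) * X) := by
      have := hg.as_sum
      rw [hg2] at this
      simpa [Finset.sum_range_succ] using this
    have hf' : f = X ^ 2 + (C (f.coeff 0) + C (f.coeff 1) * X) := by
      have := hf.as_sum
      rw [hf2] at this
      simpa [Finset.sum_range_succ] using this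
    generalize g.coeff 0 = q at hg'
    generalize g.coeff 1 = p at hg'
    generalize f.coeff 0 = q' at hf'
    generalize f.coeff 1 = p' at hf'
    have hexp : (X ^ 4 + C c * X ^ 2 + C d : F[X]) =
        X ^ 4 + C (p + p') * X ^ 3 + C (q + q' + p * p') * X ^ 2 + C (p * q' + p' * q) * X +
          C (q * q') := by
      rw [← hfg, hf', hg']
      simp only [C_add, C_mul]
      ring
    have e0 := congrArg (fun P => coeff P 0) hexp
    have e1 := congrArg (fun P => coeff P 1) hexp
    have e2 := congrArg (fun P => coeff P 2) hexp
    have e3 := congrArg (fun P => coeff P 3) hexp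
    simp [coeff_X, coeff_C, coeff_X_pow, -map_add, -map_mul] at e0 e1 e2 e3
    have hp' : p' = -p := by linear_combination -e3
    subst hp'
    have h3 : p * (q' - q) = 0 := by linear_combination -e1
    rcases mul_eq_zero.1 h3 with rfl | h3
    · exact hD ⟨q - q', by linear_combination (c + q + q') * e2 - 4 * e0⟩
    · exact hd q (by linear_combination (-q) * h3 - e0) ⟨p, by linear_combination -h3 - e2⟩

end Quartic

section Root

variable {F : Type u} [Field F] {L : Type v} [Field L] [Algebra F L] {x : L} {c d : F}

namespace IsGenWithMinpoly

theorem isIntegral (h : IsGenWithMinpoly F L x c d) : IsIntegral F x := by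
  by_contra hx
  have h0 := minpoly.eq_zero hx
  rw [h.2] at h0
  exact (monic_evenQuartic c d).ne_zero h0

theorem irreducible (h : IsGenWithMinpoly F L x c d) :
    Irreducible (X ^ 4 + C c * X ^ 2 + C d : F[X]) := by
  rw [← h.2]
  exact minpoly.irreducible h.isIntegral

theorem finrank (h : IsGenWithMinpoly F L x c d) : Module.finrank F L = 4 := by
  rw [← finrank_top', ← h.1, adjoin.finrank h.isIntegral, h.2, natDegree_evenQuartic]

theorem finiteDimensional (h : IsGenWithMinpoly F L x c d) : FiniteDimensional F L :=
  Module.finite_of_finrank_pos (by rw [h.finrank]; norm_num)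

theorem eq_zero (h : IsGenWithMinpoly F L x c d) :
    x ^ 4 + algebraMap F L c * x ^ 2 + algebraMap F L d = 0 := by
  have := minpoly.aeval F x
  rw [h.2] at this
  simpa using this

/-- The powers `1, x, x ^ 2, x ^ 3` are linearly independent. -/
theorem coeff_eq_zero (h : IsGenWithMinpoly F L x c d) {a₀ a₁ a₂ a₃ : F}
    (h0 : algebraMap F L a₀ + algebraMap F L a₁ * x + algebraMap F L a₂ * x ^ 2 +
      algebraMap F L a₃ * x ^ 3 = 0) : a₀ = 0 ∧ a₁ = 0 ∧ a₂ = 0 ∧ a₃ = 0 := by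
  set P : F[X] := C a₀ + C a₁ * X + C a₂ * X ^ 2 + C a₃ * X ^ 3 with hP
  have hdeg : P.natDegree < (minpoly F x).natDegree := by
    rw [h.2, natDegree_evenQuartic, hP]
    refine lt_of_le_of_lt (b := 3) ?_ (by norm_num)
    compute_degree
  have hz : P = 0 := by
    by_contra hne
    have := natDegree_le_natDegree (minpoly.degree_le_of_ne_zero F x hne (by simpa [hP] using h0))
    omega
  have e0 := congrArg (fun P => coeff P 0) hz
  have e1 := congrArg (fun P => coeff P 1) hz
  have e2 := congrArg (fun P => coeff P 2) hz
  have e3 := congrArg (fun P => coeff P 3) hz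
  simp [hP, coeff_X, coeff_C, coeff_X_pow] at e0 e1 e2 e3
  exact ⟨e0, e1, e2, e3⟩

/-- The powers `1, x, x ^ 2, x ^ 3` span `L`. -/
theorem exists_coeff (h : IsGenWithMinpoly F L x c d) (y : L) :
    ∃ a₀ a₁ a₂ a₃ : F, y = algebraMap F L a₀ + algebraMap F L a₁ * x + algebraMap F L a₂ * x ^ 2 +
      algebraMap F L a₃ * x ^ 3 := by
  have hy : y ∈ F⟮x⟯.toSubalgebra := by
    change y ∈ F⟮x⟯
    rw [h.1]
    trivial
  rw [adjoin_simple_toSubalgebra_of_isAlgebraic h.isIntegral.isAlgebraic,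
    Algebra.adjoin_singleton_eq_range_aeval] at hy
  obtain ⟨P, rfl⟩ := hy
  have hm := minpoly.monic h.isIntegral
  have hlt : (P %ₘ minpoly F x).natDegree < 4 := by
    have := natDegree_modByMonic_lt P hm (fun h1 => by
      have h4 := natDegree_evenQuartic c d
      rw [← h.2, h1] at h4
      simp at h4)
    rwa [h.2, natDegree_evenQuartic, ← h.2] at this
  refine ⟨(P %ₘ minpoly F x).coeff 0, (P %ₘ minpoly F x).coeff 1, (P %ₘ minpoly F x).coeff 2,
    (P %ₘ minpoly F x).coeff 3, ?_⟩
  change aeval x P = _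
  rw [← minpoly.aeval_modByMonic_minpoly, aeval_eq_sum_range' hlt]
  simp [Finset.sum_range_succ, Algebra.smul_def]

/-- A root in `L` of an irreducible even quartic is again a generator. -/
theorem of_root (h : IsGenWithMinpoly F L x c d) {y : L} {c' d' : F}
    (hirr : Irreducible (X ^ 4 + C c' * X ^ 2 + C d' : F[X]))
    (hy : y ^ 4 + algebraMap F L c' * y ^ 2 + algebraMap F L d' = 0) :
    IsGenWithMinpoly F L y c' d' := by
  have hmin : minpoly F y = X ^ 4 + C c' * X ^ 2 + C d' :=
    (minpoly.eq_of_irreducible_of_monic hirr (by simpa using hy) (monic_evenQuartic c' d')).symm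
  refine ⟨?_, hmin⟩
  have := h.finiteDimensional
  refine eq_of_le_of_finrank_eq le_top ?_
  rw [adjoin.finrank (IsIntegral.of_finite F y), hmin, natDegree_evenQuartic, finrank_top',
    h.finrank]

/-- Extensions generated by roots of the same even quartic are isomorphic. -/
theorem exists_algEquiv (h : IsGenWithMinpoly F L x c d) {L' : Type*} [Field L'] [Algebra F L']
    {x' : L'} (h' : IsGenWithMinpoly F L' x' c d) : ∃ e : L ≃ₐ[F] L', e x = x' := by
  have := h.finiteDimensional
  have := h'.finiteDimensional
  have hroot : aeval x' (minpoly F x) = 0 := by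
    rw [h.2, ← h'.2]
    exact minpoly.aeval F x'
  let φ : F⟮x⟯ →ₐ[F] L' :=
    (AdjoinRoot.liftAlgHom _ (Algebra.ofId F L') x' hroot).comp
      (adjoinRootEquivAdjoin F h.isIntegral).symm.toAlgHom
  have hφ : φ (AdjoinSimple.gen F x) = x' := by
    change AdjoinRoot.liftAlgHom _ (Algebra.ofId F L') x' hroot
      ((adjoinRootEquivAdjoin F h.isIntegral).symm (AdjoinSimple.gen F x)) = x'
    rw [adjoinRootEquivAdjoin_symm_apply_gen]
    exact AdjoinRoot.lift_root hroot
  let φ' : L →ₐ[F] L' := φ.comp ((topEquiv.symm.trans (equivOfEq h.1.symm)).toAlgHom)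
  exact ⟨AlgEquiv.ofBijective φ' ⟨φ'.injective,
    (LinearMap.injective_iff_surjective_of_finrank_eq_finrank (f := φ'.toLinearMap)
      (by rw [h.finrank, h'.finrank])).1 φ'.injective⟩, hφ⟩

theorem algEquiv_ext (h : IsGenWithMinpoly F L x c d) {σ τ : L ≃ₐ[F] L} (hx : σ x = τ x) :
    σ = τ := by
  ext y
  obtain ⟨a₀, a₁, a₂, a₃, rfl⟩ := h.exists_coeff y
  simp [hx]

theorem map (h : IsGenWithMinpoly F L x c d) {L' : Type*} [Field L'] [Algebra F L']
    (e : L ≃ₐ[F] L') : IsGenWithMinpoly F L' (e x) c d := by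
  refine ⟨?_, by rw [minpoly.algEquiv_eq, h.2]⟩
  have := congrArg (IntermediateField.map (e : L →ₐ[F] L')) h.1
  rw [adjoin_map, Set.image_singleton] at this
  rw [show (e x) = (e : L →ₐ[F] L') x from rfl, this, ← AlgHom.fieldRange_eq_map,
    AlgEquiv.fieldRange_eq_top]

end IsGenWithMinpoly

/-- Every irreducible even quartic is the minimal polynomial of a generator of some extension. -/
theorem isGenWithMinpoly_adjoinRoot {c d : F}
    [Fact (Irreducible (X ^ 4 + C c * X ^ 2 + C d : F[X]))] :
    IsGenWithMinpoly F (AdjoinRoot (X ^ 4 + C c * X ^ 2 + C d : F[X])) (AdjoinRoot.root _) c d := by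
  have hm := monic_evenQuartic c d
  refine ⟨?_, ?_⟩
  · rw [eq_top_iff, ← toSubalgebra_le_toSubalgebra, top_toSubalgebra,
      ← AdjoinRoot.adjoinRoot_eq_top]
    exact algebra_adjoin_le_adjoin _ _
  · rw [AdjoinRoot.minpoly_root hm.ne_zero, hm.leadingCoeff]
    simp

end Root

/-! ### The quadratic subfield of a biquadratic extension -/

section Galois

variable {F : Type u} [Field F] {L : Type v} [Field L] [Algebra F L] {x : L} {c d : F}

theorem two_ne_zero_of_algebra (L : Type v) [Field L] [Algebra F L] (h2 : (2 : F) ≠ 0) :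
    (2 : L) ≠ 0 := by
  rw [← map_ofNat (algebraMap F L) 2]
  exact (_root_.map_ne_zero _).2 h2

/-- If `w ^ 2` lies in `F`, then `F[w] = F + F w`. -/
theorem exists_of_mem_adjoin {w : L} {D : F} (hD : w ^ 2 = algebraMap F L D) {z : L}
    (hz : z ∈ Algebra.adjoin F {w}) : ∃ a b : F, z = algebraMap F L a + algebraMap F L b * w := by
  induction hz using Algebra.adjoin_induction with
  | mem z hz => exact ⟨0, 1, by rw [Set.mem_singleton_iff.1 hz]; simp⟩
  | algebraMap a => exact ⟨a, 0, by simp⟩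
  | add z z' _ _ h h' =>
    obtain ⟨a, b, rfl⟩ := h
    obtain ⟨a', b', rfl⟩ := h'
    exact ⟨a + a', b + b', by simp only [map_add]; ring⟩
  | mul z z' _ _ h h' =>
    obtain ⟨a, b, rfl⟩ := h
    obtain ⟨a', b', rfl⟩ := h'
    refine ⟨a * a' + b * b' * D, a * b' + b * a', ?_⟩
    simp only [map_add, map_mul, ← hD]
    ring

namespace IsGenWithMinpoly

theorem ne_zero (h : IsGenWithMinpoly F L x c d) : x ≠ 0 := by
  intro h0
  have := (h.coeff_eq_zero (a₀ := 0) (a₁ := 1) (a₂ := 0) (a₃ := 0) (by simp [h0])).2.1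
  exact one_ne_zero this

theorem const_ne_zero (h : IsGenWithMinpoly F L x c d) : d ≠ 0 := by
  rintro rfl
  have h0 := h.eq_zero
  have h1 : x ^ 2 * (x ^ 2 + algebraMap F L c) = 0 := by
    rw [map_zero] at h0
    linear_combination h0
  rcases mul_eq_zero.1 h1 with h1 | h1
  · exact h.ne_zero (pow_eq_zero_iff two_ne_zero |>.1 h1)
  · have := (h.coeff_eq_zero (a₀ := c) (a₁ := 0) (a₂ := 1) (a₃ := 0)
      (by simp; linear_combination h1)).2.2.1
    exact one_ne_zero this

theorem not_isSquare_disc (h : IsGenWithMinpoly F L x c d) (h2 : (2 : F) ≠ 0) :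
    ¬ IsSquare (c ^ 2 - 4 * d) := by
  rintro ⟨e, he⟩
  have he' := congrArg (algebraMap F L) he
  simp only [map_sub, map_mul, map_pow, map_ofNat] at he'
  have h1 : (2 * x ^ 2 + algebraMap F L (c - e)) * (2 * x ^ 2 + algebraMap F L (c + e)) = 0 := by
    simp only [map_sub, map_add]
    linear_combination 4 * h.eq_zero + he'
  rcases mul_eq_zero.1 h1 with h1 | h1
  · exact h2 (h.coeff_eq_zero (a₀ := c - e) (a₁ := 0) (a₂ := 2) (a₃ := 0)
      (by rw [map_zero, map_ofNat]; linear_combination h1)).2.2.1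
  · exact h2 (h.coeff_eq_zero (a₀ := c + e) (a₁ := 0) (a₂ := 2) (a₃ := 0)
      (by rw [map_zero, map_ofNat]; linear_combination h1)).2.2.1

/-- The element `2 x ^ 2 + c` is a square root of the discriminant `c ^ 2 - 4 d`. -/
theorem sqrt_disc_sq (h : IsGenWithMinpoly F L x c d) :
    (2 * x ^ 2 + algebraMap F L c) ^ 2 = algebraMap F L (c ^ 2 - 4 * d) := by
  simp only [map_sub, map_mul, map_pow, map_ofNat]
  linear_combination 4 * h.eq_zero

/-- With `w = 2 x ^ 2 + c`, the elements `1, w, x, w x` span `L`. -/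
theorem exists_coord (h : IsGenWithMinpoly F L x c d) (h2 : (2 : F) ≠ 0) {w : L}
    (hw : w = 2 * x ^ 2 + algebraMap F L c) (y : L) :
    ∃ p q p' q' : F, y = (algebraMap F L p + algebraMap F L q * w) +
      (algebraMap F L p' + algebraMap F L q' * w) * x := by
  have h2' := two_ne_zero_of_algebra L h2
  obtain ⟨a₀, a₁, a₂, a₃, rfl⟩ := h.exists_coeff y
  refine ⟨a₀ - a₂ * c / 2, a₂ / 2, a₁ - a₃ * c / 2, a₃ / 2, ?_⟩
  subst hw
  simp only [map_sub, map_mul, map_div₀, map_ofNat]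
  field_simp
  ring

/-- With `w = 2 x ^ 2 + c`, the elements `1, w, x, w x` are linearly independent. -/
theorem coord_eq_zero (h : IsGenWithMinpoly F L x c d) (h2 : (2 : F) ≠ 0) {w : L}
    (hw : w = 2 * x ^ 2 + algebraMap F L c) {p q p' q' : F}
    (h0 : (algebraMap F L p + algebraMap F L q * w) +
      (algebraMap F L p' + algebraMap F L q' * w) * x = 0) : p = 0 ∧ q = 0 ∧ p' = 0 ∧ q' = 0 := by
  subst hw
  obtain ⟨e0, e1, e2, e3⟩ := h.coeff_eq_zero (a₀ := p + q * c) (a₁ := p' + q' * c) (a₂ := q * 2)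
    (a₃ := q' * 2) (by
      simp only [map_add, map_mul, map_ofNat]
      linear_combination h0)
  have hq : q = 0 := (mul_eq_zero.1 e2).resolve_right h2
  have hq' : q' = 0 := (mul_eq_zero.1 e3).resolve_right h2
  subst hq hq'
  simp at e0 e1
  exact ⟨e0, rfl, e1, rfl⟩

theorem sq_mem_adjoin (h2 : (2 : F) ≠ 0) {w : L} (hw : w = 2 * x ^ 2 + algebraMap F L c) :
    x ^ 2 ∈ Algebra.adjoin F {w} := by
  have h2' := two_ne_zero_of_algebra L h2
  have : x ^ 2 = algebraMap F L (-c / 2) + algebraMap F L (1 / 2) * w := by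
    rw [hw]
    simp only [map_neg, map_div₀, map_one, map_ofNat]
    field_simp
    ring
  rw [this]
  exact add_mem (Subalgebra.algebraMap_mem _ _)
    (mul_mem (Subalgebra.algebraMap_mem _ _) (Algebra.self_mem_adjoin_singleton F w))

/-- With `w = 2 x ^ 2 + c`, the elements `1, x` are linearly independent over `F[w]`. -/
theorem eq_zero_of_mem_adjoin (h : IsGenWithMinpoly F L x c d) (h2 : (2 : F) ≠ 0) {w : L}
    (hw : w = 2 * x ^ 2 + algebraMap F L c) {m n : L} (hm : m ∈ Algebra.adjoin F {w})
    (hn : n ∈ Algebra.adjoin F {w}) (h0 : m + n * x = 0) : m = 0 ∧ n = 0 := by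
  have hD := h.sqrt_disc_sq
  rw [← hw] at hD
  obtain ⟨p, q, rfl⟩ := exists_of_mem_adjoin hD hm
  obtain ⟨p', q', rfl⟩ := exists_of_mem_adjoin hD hn
  obtain ⟨rfl, rfl, rfl, rfl⟩ := h.coord_eq_zero h2 hw h0
  simp

/-- The square of `(p + q w) x` for `w = 2 x ^ 2 + c`. -/
theorem mul_gen_sq (h : IsGenWithMinpoly F L x c d) (h2 : (2 : F) ≠ 0) {w : L}
    (hw : w = 2 * x ^ 2 + algebraMap F L c) (p q : F) :
    ((algebraMap F L p + algebraMap F L q * w) * x) ^ 2 =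
      algebraMap F L ((2 * p * q * (c ^ 2 - 4 * d) - c * (p ^ 2 + q ^ 2 * (c ^ 2 - 4 * d))) / 2) +
      algebraMap F L ((p ^ 2 + q ^ 2 * (c ^ 2 - 4 * d) - 2 * p * q * c) / 2) * w := by
  have h2' := two_ne_zero_of_algebra L h2
  have hD := h.sqrt_disc_sq
  rw [← hw] at hD
  simp only [map_sub, map_mul, map_div₀, map_pow, map_add, map_ofNat] at hD ⊢
  have hx : x ^ 2 = (w - algebraMap F L c) / 2 := by
    rw [hw]
    field_simp
    ring
  rw [mul_pow, hx]
  field_simp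
  generalize algebraMap F L c = c at *
  generalize algebraMap F L d = d at *
  generalize algebraMap F L p = p at *
  generalize algebraMap F L q = q at *
  linear_combination (q ^ 2 * (w - c) + 2 * p * q) * hD

/-- If `(p + q w) x` has its square in `F` and is not zero, then `d` is a square: taking norms from
`F(w)` to `F` of `((p + q w) x) ^ 2 = t` gives `(p ^ 2 - q ^ 2 D) ^ 2 d = t ^ 2`. -/
theorem eq_zero_of_mul_gen_sq (h : IsGenWithMinpoly F L x c d) (h2 : (2 : F) ≠ 0)
    (hd : ¬ IsSquare d) {w : L} (hw : w = 2 * x ^ 2 + algebraMap F L c) {p q t : F}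
    (ht : ((algebraMap F L p + algebraMap F L q * w) * x) ^ 2 = algebraMap F L t) :
    p = 0 ∧ q = 0 := by
  rw [h.mul_gen_sq h2 hw] at ht
  obtain ⟨e0, e1, -⟩ := h.coord_eq_zero h2 hw (p' := 0) (q' := 0)
    (p := (2 * p * q * (c ^ 2 - 4 * d) - c * (p ^ 2 + q ^ 2 * (c ^ 2 - 4 * d))) / 2 - t)
    (q := (p ^ 2 + q ^ 2 * (c ^ 2 - 4 * d) - 2 * p * q * c) / 2) (by
      rw [map_sub, map_zero]
      linear_combination ht)
  have hN : (p ^ 2 - q ^ 2 * (c ^ 2 - 4 * d)) ^ 2 * d = t ^ 2 := by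
    have e0' : t = (2 * p * q * (c ^ 2 - 4 * d) - c * (p ^ 2 + q ^ 2 * (c ^ 2 - 4 * d))) / 2 := by
      linear_combination -e0
    have e1' : ((p ^ 2 + q ^ 2 * (c ^ 2 - 4 * d) - 2 * p * q * c) / 2) ^ 2 * (c ^ 2 - 4 * d) =
        0 := by
      rw [e1]
      ring
    have key : (p ^ 2 - q ^ 2 * (c ^ 2 - 4 * d)) ^ 2 * d =
        ((2 * p * q * (c ^ 2 - 4 * d) - c * (p ^ 2 + q ^ 2 * (c ^ 2 - 4 * d))) / 2) ^ 2 -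
        ((p ^ 2 + q ^ 2 * (c ^ 2 - 4 * d) - 2 * p * q * c) / 2) ^ 2 * (c ^ 2 - 4 * d) := by
      field_simp
      ring
    rw [key, e1', ← e0', sub_zero]
  have hN0 : p ^ 2 - q ^ 2 * (c ^ 2 - 4 * d) = 0 := by
    by_contra hne
    exact hd ⟨t / (p ^ 2 - q ^ 2 * (c ^ 2 - 4 * d)), by
      rw [div_mul_div_comm, eq_div_iff (mul_ne_zero hne hne)]
      linear_combination hN⟩
  have hq : q = 0 := by
    by_contra hq
    exact h.not_isSquare_disc h2 ⟨p / q, by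
      field_simp
      linear_combination -hN0⟩
  subst hq
  simpa using hN0

/-- If `d` is not a square, then `F(x ^ 2)` is the only quadratic subfield, so any generator with an
even minimal polynomial is a multiple of `x` by an element of it. -/
theorem exists_eq_mul (h : IsGenWithMinpoly F L x c d) (h2 : (2 : F) ≠ 0) (hd : ¬ IsSquare d)
    {w : L} (hw : w = 2 * x ^ 2 + algebraMap F L c) {y : L} {c' d' : F}
    (hy : IsGenWithMinpoly F L y c' d') :
    ∃ p q : F, y = (algebraMap F L p + algebraMap F L q * w) * x := by
  have h2' := two_ne_zero_of_algebra L h2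
  have hD := h.sqrt_disc_sq
  rw [← hw] at hD
  obtain ⟨p, q, p', q', hyc⟩ := h.exists_coord h2 hw y
  set u := algebraMap F L p + algebraMap F L q * w with hu
  set v := algebraMap F L p' + algebraMap F L q' * w with hv
  have huv : u * v = 0 := by
    by_contra hne
    have hF (a : F) : algebraMap F L a ∈ Algebra.adjoin F {w} := Subalgebra.algebraMap_mem _ a
    have hwK : w ∈ Algebra.adjoin F {w} := Algebra.self_mem_adjoin_singleton F w
    have huK : u ∈ Algebra.adjoin F {w} := add_mem (hF p) (mul_mem (hF q) hwK)
    have hvK : v ∈ Algebra.adjoin F {w} := add_mem (hF p') (mul_mem (hF q') hwK)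
    have hxK : x ^ 2 ∈ Algebra.adjoin F {w} := sq_mem_adjoin h2 hw
    -- The element `y ^ 2` is `m + n x` with `m` and `n` in `F(w)` and `n ≠ 0`.
    set m := u ^ 2 + v ^ 2 * x ^ 2 with hmdef
    set n := u * v + u * v with hndef
    have hmK : m ∈ Algebra.adjoin F {w} := add_mem (pow_mem huK 2) (mul_mem (pow_mem hvK 2) hxK)
    have hnK : n ∈ Algebra.adjoin F {w} := add_mem (mul_mem huK hvK) (mul_mem huK hvK)
    have hn0 : n ≠ 0 := by
      rw [hndef, ← two_mul]
      exact mul_ne_zero h2' hne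
    obtain ⟨n₀, n₁, hn⟩ := exists_of_mem_adjoin hD hnK
    have hy2 : y ^ 2 = m + n * x := by
      rw [hyc]
      ring
    have hrel := hy.eq_zero
    obtain ⟨hs, ht⟩ := h.eq_zero_of_mem_adjoin h2 hw
      (m := m ^ 2 + n ^ 2 * x ^ 2 + algebraMap F L c' * m + algebraMap F L d')
      (n := (m + m + algebraMap F L c') * n)
      (add_mem (add_mem (add_mem (pow_mem hmK 2) (mul_mem (pow_mem hnK 2) hxK))
        (mul_mem (hF c') hmK)) (hF d'))
      (mul_mem (add_mem (add_mem hmK hmK) (hF c')) hnK) (by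
        rw [← hrel, show y ^ 4 = (y ^ 2) ^ 2 by ring, hy2]
        ring)
    -- Then `m = - c' / 2` and `(n x) ^ 2 = c' ^ 2 / 4 - d'` lies in `F`.
    have hmc : 2 * m + algebraMap F L c' = 0 :=
      by
      linear_combination (mul_eq_zero.1 ht).resolve_right hn0
    have hnx : ((algebraMap F L n₀ + algebraMap F L n₁ * w) * x) ^ 2 =
        algebraMap F L (c' ^ 2 / 4 - d') := by
      rw [← hn, mul_pow]
      have h4 : (4 : L) ≠ 0 := by
        rw [show (4 : L) = 2 * 2 by norm_num]
        exact mul_ne_zero h2' h2'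
      have hmc' : m = - algebraMap F L c' / 2 := by
        field_simp
        linear_combination hmc
      rw [hmc'] at hs
      simp only [map_sub, map_div₀, map_pow, map_ofNat]
      rw [← sub_eq_zero, ← hs]
      field_simp
      ring
    obtain ⟨rfl, rfl⟩ := h.eq_zero_of_mul_gen_sq h2 hd hw hnx
    simp only [map_zero, zero_mul, add_zero] at hn
    exact hn0 hn
  rcases mul_eq_zero.1 huv with h0 | h0
  · exact ⟨p', q', by rw [hyc, h0, zero_add]⟩
  · exfalso
    have hyK : y = u := by rw [hyc, h0, zero_mul, add_zero]
    have := (hy.coeff_eq_zero (a₀ := p ^ 2 - q ^ 2 * (c ^ 2 - 4 * d)) (a₁ := -2 * p) (a₂ := 1)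
      (a₃ := 0) (by
        rw [map_sub, map_mul (algebraMap F L) (q ^ 2), ← hD]
        simp only [map_mul, map_neg, map_pow, map_one, map_zero, map_ofNat]
        rw [hyK, hu]
        ring)).2.2.1
    exact one_ne_zero this

/-- The coefficients of an even minimal polynomial of `(p + q w) x`. -/
theorem mul_gen_coeff (h : IsGenWithMinpoly F L x c d) (h2 : (2 : F) ≠ 0) {w : L}
    (hw : w = 2 * x ^ 2 + algebraMap F L c) {p q c' d' : F}
    (hy : IsGenWithMinpoly F L ((algebraMap F L p + algebraMap F L q * w) * x) c' d') :
    c' = c * (p ^ 2 + q ^ 2 * (c ^ 2 - 4 * d)) - 2 * p * q * (c ^ 2 - 4 * d) ∧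
      d' = (p ^ 2 - q ^ 2 * (c ^ 2 - 4 * d)) ^ 2 * d := by
  have hD := h.sqrt_disc_sq
  rw [← hw] at hD
  have hsq := h.mul_gen_sq h2 hw p q
  have hrel := hy.eq_zero
  rw [show ∀ z : L, z ^ 4 = (z ^ 2) ^ 2 by intro z; ring, hsq] at hrel
  set A := (2 * p * q * (c ^ 2 - 4 * d) - c * (p ^ 2 + q ^ 2 * (c ^ 2 - 4 * d))) / 2 with hA
  set B := (p ^ 2 + q ^ 2 * (c ^ 2 - 4 * d) - 2 * p * q * c) / 2 with hB
  obtain ⟨e0, e1, -⟩ := h.coord_eq_zero h2 hw (p := A ^ 2 + B ^ 2 * (c ^ 2 - 4 * d) + c' * A + d')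
    (q := 2 * A * B + c' * B) (p' := 0) (q' := 0) (by
      rw [map_add, map_add, map_add, map_mul (algebraMap F L) (B ^ 2), ← hD]
      simp only [map_add, map_mul, map_pow, map_ofNat, map_zero]
      linear_combination hrel)
  have hB0 : B ≠ 0 := by
    intro hB0
    rw [hB0, map_zero, zero_mul, add_zero] at hsq
    have := (hy.coeff_eq_zero (a₀ := -A) (a₁ := 0) (a₂ := 1) (a₃ := 0) (by
        rw [map_neg, map_zero, map_one]
        linear_combination hsq)).2.2.1
    exact one_ne_zero this
  have hc' : c' = -2 * A := by
    have : B * (c' + 2 * A) = 0 := by linear_combination e1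
    linear_combination (mul_eq_zero.1 this).resolve_left hB0
  have hd' : d' = A ^ 2 - B ^ 2 * (c ^ 2 - 4 * d) := by
    rw [hc'] at e0
    linear_combination e0
  rw [hc', hd', hA, hB]
  constructor <;> field_simp <;> ring

/-- Converse of `mul_gen_coeff`: the quartic with these coefficients has the root `(p + q w) x`. -/
theorem mul_gen_root (h : IsGenWithMinpoly F L x c d) (h2 : (2 : F) ≠ 0) {w : L}
    (hw : w = 2 * x ^ 2 + algebraMap F L c) {p q c' d' : F}
    (hc' : c' = c * (p ^ 2 + q ^ 2 * (c ^ 2 - 4 * d)) - 2 * p * q * (c ^ 2 - 4 * d))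
    (hd' : d' = (p ^ 2 - q ^ 2 * (c ^ 2 - 4 * d)) ^ 2 * d) :
    ((algebraMap F L p + algebraMap F L q * w) * x) ^ 4 + algebraMap F L c' *
      ((algebraMap F L p + algebraMap F L q * w) * x) ^ 2 + algebraMap F L d' = 0 := by
  have hD := h.sqrt_disc_sq
  rw [← hw] at hD
  rw [show ∀ z : L, z ^ 4 = (z ^ 2) ^ 2 by intro z; ring, h.mul_gen_sq h2 hw p q]
  set A := (2 * p * q * (c ^ 2 - 4 * d) - c * (p ^ 2 + q ^ 2 * (c ^ 2 - 4 * d))) / 2 with hA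
  set B := (p ^ 2 + q ^ 2 * (c ^ 2 - 4 * d) - 2 * p * q * c) / 2 with hB
  have hc2 : c' = -2 * A := by
    rw [hc', hA]
    field_simp
    ring
  have hd2 : d' = A ^ 2 - B ^ 2 * (c ^ 2 - 4 * d) := by
    rw [hd', hA, hB]
    field_simp
    ring
  rw [hc2, hd2, map_sub, map_mul (algebraMap F L) (B ^ 2), ← hD]
  simp only [map_mul, map_pow, map_neg, map_ofNat]
  ring

end IsGenWithMinpoly

end Galois

/-! ### Galois groups of biquadratic extensions -/

section GaloisGroup

variable {F : Type u} [Field F] {L : Type v} [Field L] [Algebra F L] {x : L} {c d : F}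

theorem IsElementaryAbelianQuartic.not_isCyclicQuartic (h : IsElementaryAbelianQuartic F L) :
    ¬ IsCyclicQuartic F L := by
  rintro ⟨-, ⟨e⟩⟩
  obtain ⟨-, ⟨e'⟩⟩ := h
  have : IsCyclic (Multiplicative (ZMod 2 × ZMod 2)) :=
    isCyclic_of_surjective (e.symm.trans e') (e.symm.trans e').surjective
  exact IsKleinFour.not_isCyclic this

namespace IsGenWithMinpoly

/-- An element `y` of `L` with `x y = √d` is a further root of the minimal polynomial, which then
has the roots `± x` and `± y`, so that `L` is its splitting field. -/
theorem isGalois_of_mul_sq (h : IsGenWithMinpoly F L x c d) (h2 : (2 : F) ≠ 0) {y : L}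
    (hy : (x * y) ^ 2 = algebraMap F L d) : IsGalois F L := by
  have hx0 := h.ne_zero
  have hrel := h.eq_zero
  have hc : algebraMap F L c = -x ^ 2 - y ^ 2 := by
    have : x ^ 2 * (algebraMap F L c + x ^ 2 + y ^ 2) = 0 := by linear_combination hrel + hy
    linear_combination (mul_eq_zero.1 this).resolve_left (pow_ne_zero 2 hx0)
  have hfac : (X ^ 4 + C c * X ^ 2 + C d : F[X]).map (algebraMap F L) =
      (X - C x) * (X - C (-x)) * ((X - C y) * (X - C (-y))) := by
    simp only [Polynomial.map_add, Polynomial.map_mul, Polynomial.map_pow, map_X, map_C, hc, ← hy,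
      C_sub, C_neg, C_mul, C_pow]
    ring
  have hsep : (X ^ 4 + C c * X ^ 2 + C d : F[X]).Separable := by
    rw [separable_iff_derivative_ne_zero h.irreducible]
    intro h0
    have e1 := congrArg (fun P => coeff P 1) h0
    have e3 := congrArg (fun P => coeff P 3) h0
    simp only [coeff_derivative, coeff_add, coeff_X_pow, coeff_C_mul, coeff_C, coeff_zero] at e1 e3
    norm_num at e1 e3
    exact h2 (mul_self_eq_zero.1 (by linear_combination e3))
  have hspl : (X ^ 4 + C c * X ^ 2 + C d : F[X]).IsSplittingField F L := by
    refine ⟨?_, ?_⟩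
    · rw [hfac]
      exact ((Splits.X_sub_C _).mul (Splits.X_sub_C _)).mul
        ((Splits.X_sub_C _).mul (Splits.X_sub_C _))
    · rw [eq_top_iff, ← top_toSubalgebra, ← h.1,
        adjoin_simple_toSubalgebra_of_isAlgebraic h.isIntegral.isAlgebraic]
      refine Algebra.adjoin_mono (Set.singleton_subset_iff.2 ?_)
      rw [mem_rootSet]
      exact ⟨(monic_evenQuartic c d).ne_zero, by simpa using hrel⟩
  exact IsGalois.of_separable_splitting_field hsep

/-- The extension is Galois precisely if `√d` lies in its quadratic subfield `F(√(c ^ 2 - 4 d))`. -/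
theorem isGalois_iff (h : IsGenWithMinpoly F L x c d) (h2 : (2 : F) ≠ 0) :
    IsGalois F L ↔ IsSquare d ∨ IsSquare (d * (c ^ 2 - 4 * d)) := by
  have hx0 := h.ne_zero
  have hD := h.sqrt_disc_sq
  have hDF := h.not_isSquare_disc h2
  generalize hw : 2 * x ^ 2 + algebraMap F L c = w at hD
  have hD0 : c ^ 2 - 4 * d ≠ 0 := fun h0 => hDF ⟨0, by rw [h0]; ring⟩
  constructor
  · intro hg
    -- The cofactor of `X ^ 2 - x ^ 2` has a root `y` in `L`, and `(x y) ^ 2 = d`.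
    have hs := Normal.splits (F := F) inferInstance x
    rw [h.2] at hs
    have hfac : (X ^ 4 + C c * X ^ 2 + C d : F[X]).map (algebraMap F L) =
        (X ^ 2 - C (x ^ 2)) * (X ^ 2 + C (x ^ 2 + algebraMap F L c)) := by
      have hd : algebraMap F L d = - x ^ 2 * (x ^ 2 + algebraMap F L c) := by
        linear_combination h.eq_zero
      simp only [Polynomial.map_add, Polynomial.map_mul, Polynomial.map_pow, map_X, map_C, hd,
        C_neg, C_mul, C_pow, C_add]
      ring
    have hs2 : (X ^ 2 + C (x ^ 2 + algebraMap F L c) : L[X]).Splits := by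
      refine hs.of_dvd ?_ ?_
      · exact ((monic_evenQuartic c d).map _).ne_zero
      · rw [hfac]
        exact dvd_mul_left _ _
    obtain ⟨y, hy⟩ := hs2.exists_eval_eq_zero (by
      rw [degree_X_pow_add_C two_pos]
      norm_num)
    simp only [eval_add, eval_pow, eval_X, eval_C] at hy
    obtain ⟨p, q, p', q', hpq⟩ := h.exists_coord h2 hw.symm (x * y)
    by_contra! hcon
    obtain ⟨hd, hdD⟩ := hcon
    have hxy : (x * y) ^ 2 = algebraMap F L d := by linear_combination x ^ 2 * hy - h.eq_zero
    have hd0 := h.const_ne_zero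
    set v := algebraMap F L p' + algebraMap F L q' * w with hv
    set u := algebraMap F L p + algebraMap F L q * w with hu
    have huv : u * v = 0 := by
      have hF (a : F) : algebraMap F L a ∈ Algebra.adjoin F {w} := Subalgebra.algebraMap_mem _ a
      have hwK : w ∈ Algebra.adjoin F {w} := Algebra.self_mem_adjoin_singleton F w
      have huK : u ∈ Algebra.adjoin F {w} := add_mem (hF p) (mul_mem (hF q) hwK)
      have hvK : v ∈ Algebra.adjoin F {w} := add_mem (hF p') (mul_mem (hF q') hwK)
      have := (h.eq_zero_of_mem_adjoin h2 hw.symm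
        (m := u ^ 2 + v ^ 2 * x ^ 2 - algebraMap F L d) (n := u * v + u * v)
        (sub_mem (add_mem (pow_mem huK 2) (mul_mem (pow_mem hvK 2) (sq_mem_adjoin h2 hw.symm)))
          (hF d)) (add_mem (mul_mem huK hvK) (mul_mem huK hvK)) (by
            rw [← hxy, hpq]
            ring)).2
      rw [← two_mul] at this
      exact (mul_eq_zero.1 this).resolve_left (two_ne_zero_of_algebra L h2)
    rcases mul_eq_zero.1 huv with h0 | h0
    · rw [hpq, h0, zero_add, hv] at hxy
      obtain ⟨rfl, rfl⟩ := h.eq_zero_of_mul_gen_sq h2 hd hw.symm hxy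
      simp only [map_zero, zero_mul, add_zero, zero_pow two_ne_zero] at hxy
      exact hd0 ((map_eq_zero_iff _ (algebraMap F L).injective).1 hxy.symm)
    · rw [hpq, h0, zero_mul, add_zero, hu] at hxy
      obtain ⟨e0, e1, -⟩ := h.coord_eq_zero h2 hw.symm (p := p ^ 2 + q ^ 2 * (c ^ 2 - 4 * d) - d)
        (q := 2 * (p * q)) (p' := 0) (q' := 0) (by
          rw [map_sub, map_add, map_mul (algebraMap F L) (q ^ 2), ← hD]
          simp only [map_mul, map_pow, map_ofNat, map_zero]
          linear_combination hxy)
      rcases mul_eq_zero.1 ((mul_eq_zero.1 e1).resolve_left h2) with rfl | rfl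
      · exact hdD ⟨q * (c ^ 2 - 4 * d), by linear_combination -(c ^ 2 - 4 * d) * e0⟩
      · exact hd ⟨p, by linear_combination -e0⟩
  · rintro (⟨e, he⟩ | ⟨e, he⟩)
    · refine h.isGalois_of_mul_sq h2 (y := algebraMap F L e / x) ?_
      rw [he, mul_div_cancel₀ _ hx0, map_mul]
      ring
    · refine h.isGalois_of_mul_sq h2 (y := algebraMap F L e / w / x) ?_
      rw [mul_div_cancel₀ _ hx0, div_pow, hD, div_eq_iff, ← map_pow, ← map_mul, he, pow_two]
      exact (_root_.map_ne_zero _).2 hD0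

theorem isElementaryAbelianQuartic (h : IsGenWithMinpoly F L x c d) (h2 : (2 : F) ≠ 0)
    (hd : IsSquare d) : IsElementaryAbelianQuartic F L := by
  have hg : IsGalois F L := (h.isGalois_iff h2).2 (Or.inl hd)
  have := h.finiteDimensional
  have hx0 := h.ne_zero
  have hcard : Nat.card (L ≃ₐ[F] L) = 4 := by
    rw [IsGalois.card_aut_eq_finrank, h.finrank]
  obtain ⟨e, rfl⟩ := hd
  -- Each automorphism sends `x` to `± x` or to `± e / x`, so it is an involution.
  have hinv : ∀ σ : L ≃ₐ[F] L, σ ^ 2 = 1 := by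
    intro σ
    refine h.algEquiv_ext ?_
    rw [pow_two]
    change σ (σ x) = x
    set z := σ x with hz
    have hz0 : z ≠ 0 := by simpa [hz] using hx0
    have hrel := h.eq_zero
    have hrel' : z ^ 4 + algebraMap F L c * z ^ 2 + algebraMap F L (e * e) = 0 := by
      have := congrArg σ hrel
      simpa only [map_add, map_mul, map_pow, AlgEquiv.commutes, map_zero] using this
    rw [map_mul] at hrel hrel'
    have hprod : ((z - x) * (z + x)) * ((z * x - algebraMap F L e) * (z * x + algebraMap F L e)) =
        0 := by
      linear_combination x ^ 2 * hrel' - z ^ 2 * hrel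
    have hcancel : ∀ t : F, z * x = algebraMap F L t → σ z = x := by
      intro t ht
      have := congrArg σ ht
      rw [AlgEquiv.commutes, ← ht, map_mul, ← hz, mul_comm] at this
      exact mul_left_cancel₀ hz0 this
    rcases mul_eq_zero.1 hprod with h0 | h0 <;> rcases mul_eq_zero.1 h0 with h0 | h0
    · rw [sub_eq_zero.1 h0, ← hz, sub_eq_zero.1 h0]
    · rw [eq_neg_of_add_eq_zero_left h0, map_neg, ← hz, eq_neg_of_add_eq_zero_left h0, neg_neg]
    · exact hcancel e (sub_eq_zero.1 h0)
    · exact hcancel (-e) (by rw [map_neg]; exact eq_neg_of_add_eq_zero_left h0)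
  have hk : IsKleinFour (L ≃ₐ[F] L) := by
    refine ⟨hcard, ?_⟩
    have : Nontrivial (L ≃ₐ[F] L) := by
      have : Finite (L ≃ₐ[F] L) := Nat.finite_of_card_ne_zero (by omega)
      exact Finite.one_lt_card_iff_nontrivial.1 (by omega)
    rw [Monoid.exponent_eq_prime_iff Nat.prime_two]
    exact fun σ hσ => orderOf_eq_prime (hinv σ) hσ
  exact ⟨hg, IsKleinFour.nonempty_mulEquiv⟩

theorem isCyclicQuartic (h : IsGenWithMinpoly F L x c d) (h2 : (2 : F) ≠ 0)
    (hd : IsSquare (d * (c ^ 2 - 4 * d))) : IsCyclicQuartic F L := by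
  have hg : IsGalois F L := (h.isGalois_iff h2).2 (Or.inr hd)
  have := h.finiteDimensional
  have hx0 := h.ne_zero
  have hcard : Nat.card (L ≃ₐ[F] L) = 4 := by
    rw [IsGalois.card_aut_eq_finrank, h.finrank]
  obtain ⟨e, he⟩ := hd
  have hD := h.sqrt_disc_sq
  have hDF := h.not_isSquare_disc h2
  generalize hw : 2 * x ^ 2 + algebraMap F L c = w at hD
  have hD0 : c ^ 2 - 4 * d ≠ 0 := fun h0 => hDF ⟨0, by rw [h0]; ring⟩
  -- The automorphism `σ` with `σ x = e / (w x)` satisfies `σ w = - w`, hence `σ (σ x) = - x`.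
  have hy2 : (x * (algebraMap F L e / w / x)) ^ 2 = algebraMap F L d := by
    rw [mul_div_cancel₀ _ hx0, div_pow, hD, div_eq_iff, ← map_pow, ← map_mul, he, pow_two]
    exact (_root_.map_ne_zero _).2 hD0
  have hxy : x * (algebraMap F L e / w / x) = algebraMap F L e / w := mul_div_cancel₀ _ hx0
  generalize algebraMap F L e / w / x = y at hy2 hxy
  have hrel := h.eq_zero
  have hc : algebraMap F L c = -x ^ 2 - y ^ 2 := by
    have : x ^ 2 * (algebraMap F L c + x ^ 2 + y ^ 2) = 0 := by linear_combination hrel + hy2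
    linear_combination (mul_eq_zero.1 this).resolve_left (pow_ne_zero 2 hx0)
  have hy : IsGenWithMinpoly F L y c d := h.of_root h.irreducible (by
    rw [hc, ← hy2]
    ring)
  obtain ⟨σ, hσ⟩ := h.exists_algEquiv hy
  have hσw : σ w = - w := by
    rw [← hw, map_add, map_mul, map_pow, hσ, AlgEquiv.commutes, map_ofNat, hc]
    ring
  have hσσ : σ (σ x) = - x := by
    have h1 := congrArg σ hxy
    rw [map_mul, map_div₀, AlgEquiv.commutes, hσw, hσ, div_neg, ← hxy] at h1
    rw [hσ]
    refine mul_left_cancel₀ hy.ne_zero ?_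
    rw [h1]
    ring
  have hord : orderOf σ = 4 := by
    have h4 : σ ^ 4 = 1 := by
      rw [← hcard]
      exact pow_card_eq_one'
    refine orderOf_eq_prime_pow (p := 2) (n := 1) ?_ h4
    intro h0
    have : (σ ^ 2) x = x := by
      rw [show σ ^ 2 = 1 from h0]
      rfl
    rw [pow_two, AlgEquiv.mul_apply, hσσ] at this
    have h3 : (2 : L) * x = 0 := by linear_combination -this
    exact hx0 ((mul_eq_zero.1 h3).resolve_left (two_ne_zero_of_algebra L h2))
  have hcyc : IsCyclic (L ≃ₐ[F] L) := isCyclic_of_orderOf_eq_card σ (by rw [hord, hcard])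
  refine ⟨hg, ⟨mulEquivOfCyclicCardEq ?_⟩⟩
  rw [hcard]
  simp

end IsGenWithMinpoly

end GaloisGroup

/-! ### Elementary abelian extensions and pairs of square classes -/

section Elementary

theorem triple_sq {K : Type u} [Field K] (a b : Kˣ) (i : Fin 3) :
    triple (sq a, sq b) i = sq (triple (a, b) i) := by
  fin_cases i <;> rfl

variable {F : Type u} [Field F] {L : Type v} [Field L] [Algebra F L]

theorem forall_triple_ne_one_iff {a b : Fˣ} : (∀ i, triple (sq a, sq b) i ≠ 1) ↔
    ¬ IsSquare (a : F) ∧ ¬ IsSquare (b : F) ∧ ¬ IsSquare ((a : F) * b) := by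
  rw [Fin.forall_fin_succ, Fin.forall_fin_two, ← Units.val_mul, ← sq_eq_one_iff, ← sq_eq_one_iff,
    ← sq_eq_one_iff]
  rfl

theorem isSquare_of_isSquare_mul_sq {t e : F} (he : e ≠ 0) (h : IsSquare (t * e ^ 2)) :
    IsSquare t := by
  obtain ⟨z, hz⟩ := h
  exact ⟨z / e, by rw [div_mul_div_comm, eq_div_iff (mul_ne_zero he he)]; linear_combination hz⟩

theorem irreducible_of_not_isSquare (h2 : (2 : F) ≠ 0) {a b : F} (ha : ¬ IsSquare a)
    (hb : ¬ IsSquare b) (hab : ¬ IsSquare (a * b)) :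
    Irreducible (X ^ 4 + C (-2 * (a + b)) * X ^ 2 + C ((a - b) ^ 2) : F[X]) := by
  refine irreducible_evenQuartic (fun h => hab ?_) (fun q hq h => ?_)
  · refine isSquare_of_isSquare_mul_sq (e := 2 ^ 2) (pow_ne_zero 2 h2) ?_
    rwa [show a * b * (2 ^ 2) ^ 2 = (-2 * (a + b)) ^ 2 - 4 * (a - b) ^ 2 by ring]
  · rcases sq_eq_sq_iff_eq_or_eq_neg.1 hq with rfl | rfl
    · refine ha (isSquare_of_isSquare_mul_sq (e := 2) h2 ?_)
      rwa [show a * 2 ^ 2 = 2 * (a - b) - -2 * (a + b) by ring]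
    · refine hb (isSquare_of_isSquare_mul_sq (e := 2) h2 ?_)
      rwa [show b * 2 ^ 2 = 2 * -(a - b) - -2 * (a + b) by ring]

namespace IsGenWithMinpoly

/-- A root of `X ^ 4 - 2 (a + b) X ^ 2 + (a - b) ^ 2` is a sum `√a + √b`. -/
theorem exists_sqrt {x : L} {a b : F}
    (h : IsGenWithMinpoly F L x (-2 * (a + b)) ((a - b) ^ 2)) (h2 : (2 : F) ≠ 0) :
    ∃ A B : L, A ^ 2 = algebraMap F L a ∧ B ^ 2 = algebraMap F L b ∧ x = A + B := by
  have h2' := two_ne_zero_of_algebra L h2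
  have hx0 := h.ne_zero
  have hrel := h.eq_zero
  simp only [map_mul, map_neg, map_add, map_sub, map_pow, map_ofNat] at hrel
  refine ⟨(x + algebraMap F L (a - b) / x) / 2, (x - algebraMap F L (a - b) / x) / 2, ?_, ?_, ?_⟩
  · rw [map_sub]
    field_simp
    linear_combination hrel
  · rw [map_sub]
    field_simp
    linear_combination hrel
  · field_simp
    ring

variable {x A B : L} {a b : F}

theorem sqrt_coeff_eq_zero (h2 : (2 : F) ≠ 0)
    (h : IsGenWithMinpoly F L x (-2 * (a + b)) ((a - b) ^ 2))
    (hA : A ^ 2 = algebraMap F L a) (hB : B ^ 2 = algebraMap F L b) (hx : x = A + B)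
    {k₀ k₁ k₂ k₃ : F} (h0 : algebraMap F L k₀ + algebraMap F L k₁ * A + algebraMap F L k₂ * B +
      algebraMap F L k₃ * (A * B) = 0) : k₀ = 0 ∧ k₁ = 0 ∧ k₂ = 0 ∧ k₃ = 0 := by
  have hab : b - a ≠ 0 := fun h0 => h.const_ne_zero (by linear_combination (b - a) * h0)
  -- Multiplying by `2 (b - a)` expresses everything in powers of `x`.
  have h1 : algebraMap F L (2 * (b - a) * k₀ - (b - a) * (a + b) * k₃) +
      algebraMap F L (-(3 * a + b) * k₁ + (a + 3 * b) * k₂) * x +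
      algebraMap F L ((b - a) * k₃) * x ^ 2 + algebraMap F L (k₁ - k₂) * x ^ 3 = 0 := by
    simp only [map_mul, map_neg, map_add, map_sub, map_ofNat, ← hA, ← hB] at h0 ⊢
    rw [hx]
    linear_combination 2 * (B ^ 2 - A ^ 2) * h0
  obtain ⟨e0, e1, e2, e3⟩ := h.coeff_eq_zero h1
  have hk3 : k₃ = 0 := (mul_eq_zero.1 e2).resolve_left hab
  have hk12 : k₁ = k₂ := sub_eq_zero.1 e3
  subst hk3 hk12
  have hk1 : 2 * (b - a) * k₁ = 0 := by linear_combination e1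
  have hk0 : 2 * (b - a) * k₀ = 0 := by linear_combination e0
  have := mul_ne_zero h2 hab
  exact ⟨(mul_eq_zero.1 hk0).resolve_left this, (mul_eq_zero.1 hk1).resolve_left this,
    (mul_eq_zero.1 hk1).resolve_left this, rfl⟩

theorem exists_sqrt_coeff (h : IsGenWithMinpoly F L x (-2 * (a + b)) ((a - b) ^ 2))
    (hA : A ^ 2 = algebraMap F L a) (hB : B ^ 2 = algebraMap F L b) (hx : x = A + B) (z : L) :
    ∃ k₀ k₁ k₂ k₃ : F, z = algebraMap F L k₀ + algebraMap F L k₁ * A + algebraMap F L k₂ * B +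
      algebraMap F L k₃ * (A * B) := by
  obtain ⟨a₀, a₁, a₂, a₃, rfl⟩ := h.exists_coeff z
  refine ⟨a₀ + a₂ * (a + b), a₁ + a₃ * (a + 3 * b), a₁ + a₃ * (3 * a + b), 2 * a₂, ?_⟩
  simp only [map_mul, map_add, map_ofNat, ← hA, ← hB]
  rw [hx]
  ring

theorem not_isSquare_left (h2 : (2 : F) ≠ 0)
    (h : IsGenWithMinpoly F L x (-2 * (a + b)) ((a - b) ^ 2)) : ¬ IsSquare a := by
  obtain ⟨A, B, hA, hB, hx⟩ := h.exists_sqrt h2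
  rintro ⟨t, rfl⟩
  rw [map_mul] at hA
  have : (A - algebraMap F L t) * (A + algebraMap F L t) = 0 := by linear_combination hA
  rcases mul_eq_zero.1 this with h0 | h0
  · exact one_ne_zero (sqrt_coeff_eq_zero h2 h (by rw [hA, map_mul]) hB hx
      (k₀ := -t) (k₁ := 1) (k₂ := 0) (k₃ := 0)
      (by simp only [map_neg, map_one, map_zero]; linear_combination h0)).2.1
  · exact one_ne_zero (sqrt_coeff_eq_zero h2 h (by rw [hA, map_mul]) hB hx
      (k₀ := t) (k₁ := 1) (k₂ := 0) (k₃ := 0)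
      (by simp only [map_one, map_zero]; linear_combination h0)).2.1

theorem swap (h : IsGenWithMinpoly F L x (-2 * (a + b)) ((a - b) ^ 2)) :
    IsGenWithMinpoly F L x (-2 * (b + a)) ((b - a) ^ 2) := by
  rwa [add_comm b a, show (b - a) ^ 2 = (a - b) ^ 2 by ring]

theorem not_isSquare_mul (h2 : (2 : F) ≠ 0)
    (h : IsGenWithMinpoly F L x (-2 * (a + b)) ((a - b) ^ 2)) : ¬ IsSquare (a * b) := by
  rintro ⟨t, ht⟩
  exact h.not_isSquare_disc h2 ⟨4 * t, by linear_combination 16 * ht⟩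

/-- An element of `F` that becomes a square in `F(√a, √b)` lies in one of the square classes of
`1`, `a`, `b`, `a b`. -/
theorem isSquare_of_sq_eq (h2 : (2 : F) ≠ 0)
    (h : IsGenWithMinpoly F L x (-2 * (a + b)) ((a - b) ^ 2)) {t : F} {z : L}
    (hz : z ^ 2 = algebraMap F L t) :
    IsSquare t ∨ IsSquare (t * a) ∨ IsSquare (t * b) ∨ IsSquare (t * (a * b)) := by
  obtain ⟨A, B, hA, hB, hx⟩ := h.exists_sqrt h2
  obtain ⟨k₀, k₁, k₂, k₃, rfl⟩ := h.exists_sqrt_coeff hA hB hx z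
  obtain ⟨e0, e1, e2, e3⟩ := sqrt_coeff_eq_zero h2 h hA hB hx
    (k₀ := k₀ ^ 2 + k₁ ^ 2 * a + k₂ ^ 2 * b + k₃ ^ 2 * (a * b) - t)
    (k₁ := 2 * (k₀ * k₁ + k₂ * k₃ * b)) (k₂ := 2 * (k₀ * k₂ + k₁ * k₃ * a))
    (k₃ := 2 * (k₀ * k₃ + k₁ * k₂)) (by
      simp only [map_mul, map_add, map_sub, map_pow, map_ofNat, ← hA, ← hB] at hz ⊢
      linear_combination hz)
  have f1 := (mul_eq_zero.1 e1).resolve_left h2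
  have f2 := (mul_eq_zero.1 e2).resolve_left h2
  have f3 := (mul_eq_zero.1 e3).resolve_left h2
  have ha := not_isSquare_left h2 h
  have hb := not_isSquare_left h2 h.swap
  have ha0 : a ≠ 0 := by rintro rfl; exact ha ⟨0, by simp⟩
  have hb0 : b ≠ 0 := by rintro rfl; exact hb ⟨0, by simp⟩
  by_cases hk0 : k₀ = 0
  · subst hk0
    have g1 : k₂ = 0 ∨ k₃ = 0 := by
      have : k₂ * k₃ * b = 0 := by linear_combination f1
      exact mul_eq_zero.1 ((mul_eq_zero.1 this).resolve_right hb0)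
    have g2 : k₁ = 0 ∨ k₃ = 0 := by
      have : k₁ * k₃ * a = 0 := by linear_combination f2
      exact mul_eq_zero.1 ((mul_eq_zero.1 this).resolve_right ha0)
    have g3 : k₁ = 0 ∨ k₂ = 0 := mul_eq_zero.1 (by linear_combination f3)
    rcases g1 with rfl | rfl
    · rcases g2 with rfl | rfl
      · exact Or.inr (Or.inr (Or.inr ⟨k₃ * (a * b), by linear_combination -(a * b) * e0⟩))
      · exact Or.inr (Or.inl ⟨k₁ * a, by linear_combination -a * e0⟩)
    · rcases g3 with rfl | rfl
      · exact Or.inr (Or.inr (Or.inl ⟨k₂ * b, by linear_combination -b * e0⟩))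
      · exact Or.inr (Or.inl ⟨k₁ * a, by linear_combination -a * e0⟩)
  · have hk : k₁ ^ 2 = b * k₃ ^ 2 := by
      have : k₀ * (k₁ ^ 2 - b * k₃ ^ 2) = 0 := by linear_combination k₁ * f1 - b * k₃ * f3
      exact sub_eq_zero.1 ((mul_eq_zero.1 this).resolve_left hk0)
    have hk3 : k₃ = 0 := by
      by_contra hk3
      exact hb (isSquare_of_isSquare_mul_sq hk3 ⟨k₁, by rw [← hk]; ring⟩)
    subst hk3
    have hk1 : k₁ = 0 := by simpa using hk
    subst hk1
    have hk2 : k₂ = 0 := by simpa [hk0] using f2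
    subst hk2
    exact Or.inl ⟨k₀, by linear_combination -e0⟩

end IsGenWithMinpoly

theorem triple_sq_ne_one (h2 : (2 : F) ≠ 0) {x : L} {a b : Fˣ}
    (h : IsGenWithMinpoly F L x (-2 * ((a : F) + b)) (((a : F) - b) ^ 2)) (i : Fin 3) :
    triple (sq a, sq b) i ≠ 1 := by
  revert i
  rw [forall_triple_ne_one_iff]
  exact ⟨h.not_isSquare_left h2, h.swap.not_isSquare_left h2, h.not_isSquare_mul h2⟩

/-- The field `F(√a, √b)` determines the orbit of the square classes of `a` and `b`: they are the
square classes of `F` that become trivial in it. -/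
theorem elemOrbit_eq_of_gen (h2 : (2 : F) ≠ 0) {x y : L} {a b a' b' : Fˣ}
    (h : IsGenWithMinpoly F L x (-2 * ((a : F) + b)) (((a : F) - b) ^ 2))
    (h' : IsGenWithMinpoly F L y (-2 * ((a' : F) + b')) (((a' : F) - b') ^ 2)) :
    elemOrbit a b = elemOrbit a' b' := by
  have key : ∀ (t : Fˣ) (z : L), z ^ 2 = algebraMap F L t → sq t ≠ 1 →
      ∃ i, sq t = triple (sq a', sq b') i := by
    intro t z hz ht
    rcases h'.isSquare_of_sq_eq h2 hz with h1 | h1 | h1 | h1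
    · exact absurd (sq_eq_one_iff.2 h1) ht
    · rw [← Units.val_mul, ← sq_eq_one_iff] at h1
      exact ⟨0, SqClass.eq_of_mul_eq_one h1⟩
    · rw [← Units.val_mul, ← sq_eq_one_iff] at h1
      exact ⟨1, SqClass.eq_of_mul_eq_one h1⟩
    · rw [← Units.val_mul, ← Units.val_mul, ← sq_eq_one_iff] at h1
      exact ⟨2, SqClass.eq_of_mul_eq_one h1⟩
  obtain ⟨A, B, hA, hB, -⟩ := h.exists_sqrt h2
  have hne := triple_sq_ne_one h2 h
  refine orbit_eq_of_triple ?_ (key a A hA (hne 0)) (key b B hB (hne 1))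
  intro heq
  refine hne 2 ?_
  change sq a * sq b = 1
  rw [show sq a = sq b from heq]
  exact SqClass.mul_self _

/-- The orbit of the square classes of `a` and `b` determines the field `F(√a, √b)`. -/
theorem nonempty_algEquiv_of_elemOrbit_eq (h2 : (2 : F) ≠ 0) {L' : Type*} [Field L'] [Algebra F L']
    {x : L} {y : L'} {a b a' b' : Fˣ}
    (h : IsGenWithMinpoly F L x (-2 * ((a : F) + b)) (((a : F) - b) ^ 2))
    (h' : IsGenWithMinpoly F L' y (-2 * ((a' : F) + b')) (((a' : F) - b') ^ 2))
    (heq : elemOrbit a b = elemOrbit a' b') : Nonempty (L ≃ₐ[F] L') := by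
  obtain ⟨A, B, hA, hB, -⟩ := h.exists_sqrt h2
  have hroot : ∀ i, ∃ z : L, z ^ 2 = algebraMap F L (triple (a, b) i : Fˣ) := by
    intro i
    fin_cases i
    · exact ⟨A, hA⟩
    · exact ⟨B, hB⟩
    · refine ⟨A * B, ?_⟩
      rw [mul_pow, hA, hB, ← map_mul]
      rfl
  have key : ∀ i, ∃ z : L, z ^ 2 = algebraMap F L (triple (a', b') i : Fˣ) := by
    intro i
    obtain ⟨j, hj⟩ := exists_triple_eq_of_orbit_eq heq.symm i
    rw [triple_sq, triple_sq] at hj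
    obtain ⟨e, he⟩ := sq_eq_sq_iff.1 hj
    obtain ⟨z, hz⟩ := hroot j
    exact ⟨z * algebraMap F L e, by rw [he, mul_pow, hz, map_mul, map_pow]⟩
  obtain ⟨A', hA'⟩ := key 0
  obtain ⟨B', hB'⟩ := key 1
  have hgen := h.of_root (y := A' + B') h'.irreducible (by
    simp only [map_mul, map_neg, map_add, map_sub, map_pow, map_ofNat]
    have hA1 : algebraMap F L a' = A' ^ 2 := hA'.symm
    have hB1 : algebraMap F L b' = B' ^ 2 := hB'.symm
    rw [hA1, hB1]
    ring)
  exact ⟨(hgen.exists_algEquiv h').choose⟩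

/-- If `d` is a square, the extension is of the form `F(√a, √b)`. -/
theorem IsGenWithMinpoly.exists_units (h2 : (2 : F) ≠ 0) {x : L} {c d : F}
    (h : IsGenWithMinpoly F L x c d) (hd : IsSquare d) :
    ∃ a b : Fˣ, IsGenWithMinpoly F L x (-2 * ((a : F) + b)) (((a : F) - b) ^ 2) := by
  obtain ⟨e, he⟩ := hd
  have hD := h.not_isSquare_disc h2
  have h4 : (4 : F) ≠ 0 := by
    rw [show (4 : F) = 2 * 2 by norm_num]
    exact mul_ne_zero h2 h2
  have ha : (2 * e - c) / 4 ≠ 0 := by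
    intro h0
    have : 2 * e - c = 0 := (div_eq_zero_iff.1 h0).resolve_right h4
    exact hD ⟨0, by rw [he]; linear_combination (-c - 2 * e) * this⟩
  have hb : (-2 * e - c) / 4 ≠ 0 := by
    intro h0
    have : -2 * e - c = 0 := (div_eq_zero_iff.1 h0).resolve_right h4
    exact hD ⟨0, by rw [he]; linear_combination (-c + 2 * e) * this⟩
  refine ⟨Units.mk0 _ ha, Units.mk0 _ hb, ?_⟩
  rw [Units.val_mk0, Units.val_mk0]
  convert h using 1
  · field_simp
    ring
  · rw [he]
    field_simp
    ring

end Elementary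

/-! ### Quadratic extensions -/

section Quadratic

variable {F : Type u} [Field F] {E : Type v} [Field E] [Algebra F E]

/-- `E = F + F r` is a quadratic extension with `r ^ 2 = s`, where `s` is not a square in `F`. -/
structure IsQuadraticGen (s : F) (r : E) : Prop where
  sq_eq : r ^ 2 = algebraMap F E s
  not_isSquare : ¬ IsSquare s
  exists_coord : ∀ z : E, ∃ a b : F, z = algebraMap F E a + algebraMap F E b * r

namespace IsQuadraticGen

variable {s : F} {r : E}

theorem base_ne_zero (h : IsQuadraticGen s r) : s ≠ 0 := by
  rintro rfl
  exact h.not_isSquare ⟨0, by simp⟩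

theorem coord_eq_zero (h : IsQuadraticGen s r) {a b : F}
    (h0 : algebraMap F E a + algebraMap F E b * r = 0) : a = 0 ∧ b = 0 := by
  have h1 : a ^ 2 = b ^ 2 * s := by
    apply (algebraMap F E).injective
    rw [map_mul, map_pow, map_pow, ← h.sq_eq]
    linear_combination (algebraMap F E a - algebraMap F E b * r) * h0
  have hb : b = 0 := by
    by_contra hb
    exact h.not_isSquare (isSquare_of_isSquare_mul_sq hb ⟨a, by linear_combination -h1⟩)
  subst hb
  exact ⟨by simpa using h1, rfl⟩

theorem minpoly_eq (h : IsQuadraticGen s r) : minpoly F r = X ^ 2 - C s := by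
  refine (minpoly.eq_of_irreducible_of_monic ?_ ?_ (monic_X_pow_sub_C s two_ne_zero)).symm
  · rw [X_pow_sub_C_irreducible_iff_of_prime Nat.prime_two]
    intro t ht
    exact h.not_isSquare ⟨t, by rw [← ht, pow_two]⟩
  · simp [h.sq_eq]

theorem isIntegral (h : IsQuadraticGen s r) : IsIntegral F r :=
  ⟨X ^ 2 - C s, monic_X_pow_sub_C s two_ne_zero, by simp [h.sq_eq]⟩

theorem finrank (h : IsQuadraticGen s r) : Module.finrank F E = 2 := by
  have htop : F⟮r⟯ = ⊤ := by
    rw [eq_top_iff]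
    intro z _
    obtain ⟨a, b, rfl⟩ := h.exists_coord z
    exact add_mem (F⟮r⟯.algebraMap_mem a)
      (mul_mem (F⟮r⟯.algebraMap_mem b) (mem_adjoin_simple_self F r))
  rw [← finrank_top', ← htop, adjoin.finrank h.isIntegral, h.minpoly_eq, natDegree_X_pow_sub_C]

/-- The non-trivial automorphism. -/
theorem exists_conj (h : IsQuadraticGen s r) : ∃ σ : E ≃ₐ[F] E, σ r = -r := by
  have : Algebra.IsQuadraticExtension F E := { finrank_eq_two' := h.finrank }
  exact minpoly.exists_algEquiv_of_root' h.isIntegral.isAlgebraic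
    (by rw [h.minpoly_eq]; simp [h.sq_eq])

theorem algEquiv_ext (h : IsQuadraticGen s r) {σ τ : E ≃ₐ[F] E} (hr : σ r = τ r) : σ = τ := by
  ext z
  obtain ⟨a, b, rfl⟩ := h.exists_coord z
  simp [hr]

theorem eq_one_or (h : IsQuadraticGen s r) (σ : E ≃ₐ[F] E) : σ = 1 ∨ σ r = -r := by
  have h1 : σ r ^ 2 = r ^ 2 := by rw [← map_pow, h.sq_eq, AlgEquiv.commutes]
  rcases sq_eq_sq_iff_eq_or_eq_neg.1 h1 with h1 | h1
  · exact Or.inl (h.algEquiv_ext h1)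
  · exact Or.inr h1

theorem gen_ne_neg (h : IsQuadraticGen s r) (h2 : (2 : F) ≠ 0) : r ≠ -r := by
  intro h0
  refine h2 (h.coord_eq_zero (a := 0) (b := 2) ?_).2
  rw [map_zero, map_ofNat]
  linear_combination h0

theorem zpowers_eq_top_iff (h : IsQuadraticGen s r) (h2 : (2 : F) ≠ 0) (σ : E ≃ₐ[F] E) :
    Subgroup.zpowers σ = ⊤ ↔ σ r = -r := by
  constructor
  · intro hσ
    refine (h.eq_one_or σ).resolve_left ?_
    rintro rfl
    obtain ⟨τ, hτ⟩ := h.exists_conj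
    have hmem : τ ∈ Subgroup.zpowers (1 : E ≃ₐ[F] E) := hσ ▸ Subgroup.mem_top τ
    rw [Subgroup.zpowers_one_eq_bot, Subgroup.mem_bot] at hmem
    rw [hmem] at hτ
    exact h.gen_ne_neg h2 hτ
  · intro hσ
    rw [eq_top_iff]
    intro τ _
    rcases h.eq_one_or τ with rfl | hτ
    · exact one_mem _
    · rw [h.algEquiv_ext (hτ.trans hσ.symm)]
      exact Subgroup.mem_zpowers σ

/-- An element of `F` is a square in `F(√s)` if and only if it is in the square class of `1` or of
`s`. -/
theorem isSquare_algebraMap_iff (h : IsQuadraticGen s r) (h2 : (2 : F) ≠ 0) {t : F} :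
    IsSquare (algebraMap F E t) ↔ IsSquare t ∨ IsSquare (t * s) := by
  constructor
  · rintro ⟨z, hz⟩
    obtain ⟨a, b, rfl⟩ := h.exists_coord z
    obtain ⟨e0, e1⟩ := h.coord_eq_zero (a := a ^ 2 + b ^ 2 * s - t) (b := 2 * (a * b)) (by
      rw [map_sub, map_add, map_mul (algebraMap F E) (b ^ 2), ← h.sq_eq]
      simp only [map_mul, map_pow, map_ofNat]
      linear_combination -hz)
    rcases mul_eq_zero.1 ((mul_eq_zero.1 e1).resolve_left h2) with rfl | rfl
    · exact Or.inr ⟨b * s, by linear_combination -s * e0⟩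
    · exact Or.inl ⟨a, by linear_combination -e0⟩
  · rintro (⟨e, rfl⟩ | ⟨e, he⟩)
    · exact ⟨algebraMap F E e, map_mul _ _ _⟩
    · refine isSquare_of_isSquare_mul_sq (e := r) ?_ ⟨algebraMap F E e, ?_⟩
      · intro hr
        have := h.sq_eq
        rw [hr, zero_pow two_ne_zero, eq_comm, map_eq_zero_iff _ (algebraMap F E).injective] at this
        exact h.base_ne_zero this
      · rw [h.sq_eq, ← map_mul, he, map_mul]

theorem conj_apply (hr : r ^ 2 = algebraMap F E s) {σ : E ≃ₐ[F] E} (hσ : σ r = -r) {a b : F}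
    {z : E} (hz : z = algebraMap F E a + algebraMap F E b * r) :
    σ z = algebraMap F E a - algebraMap F E b * r ∧
      z * σ z = algebraMap F E (a ^ 2 - b ^ 2 * s) := by
  have h1 : σ z = algebraMap F E a - algebraMap F E b * r := by
    rw [hz, map_add, map_mul, AlgEquiv.commutes, AlgEquiv.commutes, hσ]
    ring
  refine ⟨h1, ?_⟩
  rw [h1, hz, map_sub, map_mul, map_pow, map_pow, ← hr]
  ring

theorem mem_normSquare_iff_isSquare (h : IsQuadraticGen s r) (h2 : (2 : F) ≠ 0) {σ : E ≃ₐ[F] E}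
    (hσ : σ r = -r) {α : Eˣ} : α ∈ normSquare F E ↔ IsSquare ((α : E) * σ α) := by
  have hu : ∀ β : Eˣ, IsSquare (α * β) ↔ IsSquare ((α : E) * β) := by
    intro β
    rw [← Units.val_mul, ← sq_eq_one_iff]
    constructor
    · rintro ⟨e, he⟩
      rw [he]
      exact SqClass.mul_self (sq e)
    · intro h1
      obtain ⟨e, he⟩ := (QuotientGroup.eq_one_iff _).1 h1
      exact ⟨e, by rw [← he, ← pow_two]; rfl⟩
  constructor
  · rintro ⟨τ, hτ, hsq⟩
    rw [h.zpowers_eq_top_iff h2] at hτ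
    obtain rfl := h.algEquiv_ext (hτ.trans hσ.symm)
    exact (hu _).1 hsq
  · intro hsq
    exact ⟨σ, (h.zpowers_eq_top_iff h2 σ).2 hσ, (hu (Units.map (σ : E →* E) α)).2 hsq⟩

theorem mem_normSquare_iff (h : IsQuadraticGen s r) (h2 : (2 : F) ≠ 0) {α : Eˣ} {a b : F}
    (hα : (α : E) = algebraMap F E a + algebraMap F E b * r) :
    α ∈ normSquare F E ↔ IsSquare (a ^ 2 - b ^ 2 * s) ∨ IsSquare ((a ^ 2 - b ^ 2 * s) * s) := by
  obtain ⟨σ, hσ⟩ := h.exists_conj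
  rw [h.mem_normSquare_iff_isSquare h2 hσ, (conj_apply h.sq_eq hσ hα).2,
    h.isSquare_algebraMap_iff h2]

theorem galOrbit_eq_iff (h : IsQuadraticGen s r) {σ : E ≃ₐ[F] E} (hσ : σ r = -r) {α β : Eˣ} :
    galOrbit F α = galOrbit F β ↔ sq α = sq β ∨ sq α = sq (Units.map (σ : E →* E) β) := by
  rw [galOrbit, galOrbit, Quotient.eq, MulAction.orbitRel_apply, MulAction.mem_orbit_iff]
  constructor
  · rintro ⟨τ, hτ⟩
    rcases h.eq_one_or τ with rfl | h1
    · rw [one_smul] at hτ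
      exact Or.inl hτ.symm
    · obtain rfl := h.algEquiv_ext (h1.trans hσ.symm)
      exact Or.inr hτ.symm
  · rintro (h1 | h1)
    · exact ⟨1, by rw [one_smul, h1]⟩
    · exact ⟨σ, h1.symm⟩

end IsQuadraticGen

end Quadratic

/-! ### Non-Galois biquadratic extensions and square classes of quadratic extensions -/

section NonGalois

variable {F : Type u} [Field F] {E : Type v} [Field E] [Algebra F E] {s : F} {r : E}

theorem four_ne_zero_of_two (h2 : (2 : F) ≠ 0) : (4 : F) ≠ 0 := by
  rw [show (4 : F) = 2 * 2 by norm_num]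
  exact mul_ne_zero h2 h2

namespace IsQuadraticGen

theorem not_isSquare_const (h : IsQuadraticGen s r) (h2 : (2 : F) ≠ 0) {b : F} (hb : b ≠ 0) :
    ¬ IsSquare (b ^ 2 * s / 4) := by
  intro hsq
  refine h.not_isSquare (isSquare_of_isSquare_mul_sq (e := b / 2) (div_ne_zero hb h2) ?_)
  have h4 := four_ne_zero_of_two h2
  rwa [show s * (b / 2) ^ 2 = b ^ 2 * s / 4 by field_simp; ring]

theorem coord_ne_zero_of_not_mem (h : IsQuadraticGen s r) (h2 : (2 : F) ≠ 0) {α : Eˣ} {a b : F}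
    (hα : (α : E) = algebraMap F E a + algebraMap F E b * r) (hN : α ∉ normSquare F E) :
    b ≠ 0 := by
  rintro rfl
  exact hN ((h.mem_normSquare_iff h2 hα).2 (Or.inl ⟨a, by ring⟩))

/-- For `α = a + b √s` with `α σ(α)` not a square in `F(√s)`, the polynomial
`X ^ 4 - a X ^ 2 + b ^ 2 s / 4` is irreducible. -/
theorem irreducible (h : IsQuadraticGen s r) (h2 : (2 : F) ≠ 0) {α : Eˣ} {a b : F}
    (hα : (α : E) = algebraMap F E a + algebraMap F E b * r) (hN : α ∉ normSquare F E) :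
    Irreducible (X ^ 4 + C (-a) * X ^ 2 + C (b ^ 2 * s / 4) : F[X]) := by
  have h4 := four_ne_zero_of_two h2
  have hb := h.coord_ne_zero_of_not_mem h2 hα hN
  rw [h.mem_normSquare_iff h2 hα] at hN
  push Not at hN
  refine irreducible_evenQuartic ?_ (fun q hq => ?_)
  · rw [mul_div_cancel₀ _ h4, neg_sq]
    exact hN.1
  · exact absurd ⟨q, by rw [← hq, pow_two]⟩ (h.not_isSquare_const h2 hb)

variable {L : Type*} [Field L] [Algebra F L] {x : L} {a b : F}

/-- A non-cyclic extension generated by a root of `X ^ 4 - a X ^ 2 + b ^ 2 s / 4` yields an element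
`α = a + b √s` with `α σ(α)` not a square in `F(√s)`. -/
theorem exists_unit (h : IsQuadraticGen s r) (h2 : (2 : F) ≠ 0)
    (hx : IsGenWithMinpoly F L x (-a) (b ^ 2 * s / 4)) (hL : ¬ IsCyclicQuartic F L) :
    ∃ α : Eˣ, (α : E) = algebraMap F E a + algebraMap F E b * r ∧ α ∉ normSquare F E := by
  have h4 := four_ne_zero_of_two h2
  have hb : b ≠ 0 := by
    rintro rfl
    exact hx.const_ne_zero (by simp)
  have hne : algebraMap F E a + algebraMap F E b * r ≠ 0 := fun h0 => hb (h.coord_eq_zero h0).2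
  refine ⟨Units.mk0 _ hne, rfl, ?_⟩
  rw [h.mem_normSquare_iff h2 rfl]
  rintro (h1 | h1)
  · refine hx.not_isSquare_disc h2 ?_
    rwa [mul_div_cancel₀ _ h4, neg_sq]
  · refine hL (hx.isCyclicQuartic h2 ?_)
    rw [mul_div_cancel₀ _ h4, neg_sq, show b ^ 2 * s / 4 * (a ^ 2 - b ^ 2 * s) =
      (a ^ 2 - b ^ 2 * s) * s * (b / 2) ^ 2 by field_simp; ring]
    exact h1.mul ⟨b / 2, pow_two _⟩

theorem not_isGalois (h : IsQuadraticGen s r) (h2 : (2 : F) ≠ 0)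
    (hx : IsGenWithMinpoly F L x (-a) (b ^ 2 * s / 4)) (hL : ¬ IsCyclicQuartic F L) :
    ¬ IsGalois F L := by
  have hb : b ≠ 0 := by
    rintro rfl
    exact hx.const_ne_zero (by simp)
  rw [hx.isGalois_iff h2]
  rintro (h1 | h1)
  · exact h.not_isSquare_const h2 hb h1
  · exact hL (hx.isCyclicQuartic h2 h1)

/-- If `α` lies outside the norm condition, a root of the associated quartic does not generate a
cyclic extension. -/
theorem not_isCyclicQuartic (h : IsQuadraticGen s r) (h2 : (2 : F) ≠ 0) {α : Eˣ}
    (hα : (α : E) = algebraMap F E a + algebraMap F E b * r) (hN : α ∉ normSquare F E)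
    (hx : IsGenWithMinpoly F L x (-a) (b ^ 2 * s / 4)) : ¬ IsCyclicQuartic F L := by
  have h4 := four_ne_zero_of_two h2
  have hb := h.coord_ne_zero_of_not_mem h2 hα hN
  rintro ⟨hg, -⟩
  rcases (hx.isGalois_iff h2).1 hg with h1 | h1
  · exact h.not_isSquare_const h2 hb h1
  · refine hN ((h.mem_normSquare_iff h2 hα).2 (Or.inr ?_))
    refine isSquare_of_isSquare_mul_sq (e := b / 2) (div_ne_zero hb h2) ?_
    rwa [mul_div_cancel₀ _ h4, neg_sq, show b ^ 2 * s / 4 * (a ^ 2 - b ^ 2 * s) =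
      (a ^ 2 - b ^ 2 * s) * s * (b / 2) ^ 2 by field_simp; ring] at h1

/-- The square class of `s` is determined by the extension, being the class of the constant term of
the minimal polynomial of any generator. -/
theorem isSquare_mul_of_gen (h : IsQuadraticGen s r) (h2 : (2 : F) ≠ 0) {s' a' b' : F} {y : L}
    (hx : IsGenWithMinpoly F L x (-a) (b ^ 2 * s / 4))
    (hy : IsGenWithMinpoly F L y (-a') (b' ^ 2 * s' / 4)) : IsSquare (s' * s) := by
  have h4 := four_ne_zero_of_two h2
  have hb : b ≠ 0 := by
    rintro rfl
    exact hx.const_ne_zero (by simp)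
  have hb' : b' ≠ 0 := by
    rintro rfl
    exact hy.const_ne_zero (by simp)
  obtain ⟨p, q, rfl⟩ := hx.exists_eq_mul h2 (h.not_isSquare_const h2 hb) rfl hy
  have hd := (hx.mul_gen_coeff h2 rfl hy).2
  refine isSquare_of_isSquare_mul_sq hb'
    ⟨(p ^ 2 - q ^ 2 * ((-a) ^ 2 - 4 * (b ^ 2 * s / 4))) * b * s, ?_⟩
  generalize p ^ 2 - q ^ 2 * ((-a) ^ 2 - 4 * (b ^ 2 * s / 4)) = N at hd
  field_simp at hd
  linear_combination s * hd

/-- If `x` is replaced by another generator `(p + q w) x`, then `α = a + b √s` is replaced by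
`α (p + q σ(α)) ^ 2` or its conjugate. -/
theorem galOrbit_eq_of_gen (h : IsQuadraticGen s r) (h2 : (2 : F) ≠ 0) {a' b' : F} {y : L}
    (hx : IsGenWithMinpoly F L x (-a) (b ^ 2 * s / 4))
    (hy : IsGenWithMinpoly F L y (-a') (b' ^ 2 * s / 4)) {α α' : Eˣ}
    (hα : (α : E) = algebraMap F E a + algebraMap F E b * r)
    (hα' : (α' : E) = algebraMap F E a' + algebraMap F E b' * r) :
    galOrbit F α' = galOrbit F α := by
  have h4 := four_ne_zero_of_two h2
  have hs0 := h.base_ne_zero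
  obtain ⟨σ, hσ⟩ := h.exists_conj
  have hb : b ≠ 0 := by
    rintro rfl
    exact hx.const_ne_zero (by simp)
  obtain ⟨p, q, rfl⟩ := hx.exists_eq_mul h2 (h.not_isSquare_const h2 hb) rfl hy
  obtain ⟨hc, hd⟩ := hx.mul_gen_coeff h2 rfl hy
  rw [mul_div_cancel₀ _ h4, neg_sq] at hc hd
  have ha' : a' = a * (p ^ 2 + q ^ 2 * (a ^ 2 - b ^ 2 * s)) + 2 * p * q * (a ^ 2 - b ^ 2 * s) := by
    linear_combination -hc
  have hbb : b' ^ 2 = ((p ^ 2 - q ^ 2 * (a ^ 2 - b ^ 2 * s)) * b) ^ 2 := by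
    have : s * (b' ^ 2 - ((p ^ 2 - q ^ 2 * (a ^ 2 - b ^ 2 * s)) * b) ^ 2) = 0 := by
      field_simp at hd
      linear_combination s * hd
    exact sub_eq_zero.1 ((mul_eq_zero.1 this).resolve_left hs0)
  have hr := h.sq_eq
  rw [h.galOrbit_eq_iff hσ]
  rcases sq_eq_sq_iff_eq_or_eq_neg.1 hbb with hb' | hb'
  · left
    refine sq_eq_sq_iff.2 ⟨algebraMap F E p + algebraMap F E q * σ α, ?_⟩
    rw [(conj_apply hr hσ hα).1, hα', hα, ha', hb']
    simp only [map_add, map_sub, map_mul, map_pow, map_ofNat, ← hr]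
    ring
  · right
    refine sq_eq_sq_iff.2 ⟨algebraMap F E p + algebraMap F E q * α, ?_⟩
    change (α' : E) = σ α * _
    rw [(conj_apply hr hσ hα).1, hα', hα, ha', hb']
    simp only [map_add, map_sub, map_mul, map_pow, map_ofNat, map_neg, ← hr]
    ring

theorem nonempty_algEquiv_of_sq_eq (h : IsQuadraticGen s r) (h2 : (2 : F) ≠ 0) {L' : Type*}
    [Field L'] [Algebra F L'] {a' b' : F} {y : L'}
    (hx : IsGenWithMinpoly F L x (-a) (b ^ 2 * s / 4))
    (hy : IsGenWithMinpoly F L' y (-a') (b' ^ 2 * s / 4)) {α α' : Eˣ}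
    (hα : (α : E) = algebraMap F E a + algebraMap F E b * r)
    (hα' : (α' : E) = algebraMap F E a' + algebraMap F E b' * r)
    (heq : sq α' = sq α) : Nonempty (L ≃ₐ[F] L') := by
  have h4 := four_ne_zero_of_two h2
  obtain ⟨σ, hσ⟩ := h.exists_conj
  have hb : b ≠ 0 := by
    rintro rfl
    exact hx.const_ne_zero (by simp)
  obtain ⟨e, he⟩ := sq_eq_sq_iff.1 heq
  -- As `b ≠ 0`, the elements `1` and `σ α` form a basis of `F(√s)`.
  obtain ⟨k, l, hkl⟩ := h.exists_coord e
  obtain ⟨p, q, hpq⟩ : ∃ p q : F, e = algebraMap F E p + algebraMap F E q * σ α := by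
    refine ⟨k + l * a / b, -l / b, ?_⟩
    have hb' : algebraMap F E b ≠ 0 := (_root_.map_ne_zero _).2 hb
    rw [(conj_apply h.sq_eq hσ hα).1, hkl]
    simp only [map_add, map_mul, map_div₀, map_neg]
    field_simp
    ring
  have hr := h.sq_eq
  rw [hpq, (conj_apply h.sq_eq hσ hα).1, hα, hα'] at he
  obtain ⟨e0, e1⟩ := h.coord_eq_zero
    (a := a' - (a * (p ^ 2 + q ^ 2 * (a ^ 2 - b ^ 2 * s)) + 2 * p * q * (a ^ 2 - b ^ 2 * s)))
    (b := b' - (p ^ 2 - q ^ 2 * (a ^ 2 - b ^ 2 * s)) * b) (by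
      simp only [map_add, map_sub, map_mul, map_pow, map_ofNat, ← hr]
      linear_combination he)
  have hroot := hx.mul_gen_root h2 rfl (p := p) (q := q) (c' := -a') (d' := b' ^ 2 * s / 4) (by
      rw [mul_div_cancel₀ _ h4, neg_sq]
      linear_combination -e0) (by
      rw [mul_div_cancel₀ _ h4, neg_sq, sub_eq_zero.1 e1]
      ring)
  exact ⟨((hx.of_root hy.irreducible hroot).exists_algEquiv hy).choose⟩

/-- The Galois orbit of the square class of `a + b √s` determines the extension. -/
theorem nonempty_algEquiv_of_galOrbit_eq (h : IsQuadraticGen s r) (h2 : (2 : F) ≠ 0) {L' : Type*}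
    [Field L'] [Algebra F L'] {a' b' : F} {y : L'}
    (hx : IsGenWithMinpoly F L x (-a) (b ^ 2 * s / 4))
    (hy : IsGenWithMinpoly F L' y (-a') (b' ^ 2 * s / 4)) {α α' : Eˣ}
    (hα : (α : E) = algebraMap F E a + algebraMap F E b * r)
    (hα' : (α' : E) = algebraMap F E a' + algebraMap F E b' * r)
    (heq : galOrbit F α' = galOrbit F α) : Nonempty (L ≃ₐ[F] L') := by
  obtain ⟨σ, hσ⟩ := h.exists_conj
  rcases (h.galOrbit_eq_iff hσ).1 heq with h1 | h1
  · exact h.nonempty_algEquiv_of_sq_eq h2 hx hy hα hα' h1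
  · refine h.nonempty_algEquiv_of_sq_eq h2 (b := -b) (by rwa [neg_sq]) hy ?_ hα' h1
    change σ α = _
    rw [(conj_apply h.sq_eq hσ hα).1, map_neg]
    ring

end IsQuadraticGen

end NonGalois

/-! ### Classification of non-cyclic biquadratic extensions -/

section Classification

variable {F : Type u} [Field F] {Ω : Type v} [Field Ω] [Algebra F Ω] {S : Set Fˣ}

theorem isQuadraticGen_sqrtField {s : Fˣ} (hs : ¬ IsSquare (s : F)) {r : sqrtField Ω s}
    (hr : r ^ 2 = algebraMap F (sqrtField Ω s) s) : IsQuadraticGen (s : F) r := by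
  refine ⟨hr, hs, fun z => ?_⟩
  have hr' : (r : Ω) ^ 2 = algebraMap F Ω s := congrArg Subtype.val hr
  have hle : sqrtField Ω s ≤ F⟮(r : Ω)⟯ := by
    refine adjoin_le_iff.2 fun t ht => ?_
    have ht' : t ^ 2 = (r : Ω) ^ 2 := by rw [hr']; exact ht
    rcases sq_eq_sq_iff_eq_or_eq_neg.1 ht' with rfl | rfl
    · exact mem_adjoin_simple_self F _
    · exact neg_mem (mem_adjoin_simple_self F _)
  have hint : IsIntegral F (r : Ω) :=
    ⟨X ^ 2 - C (s : F), monic_X_pow_sub_C _ two_ne_zero, by simp [hr']⟩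
  have hz : (z : Ω) ∈ Algebra.adjoin F {(r : Ω)} := by
    rw [← adjoin_simple_toSubalgebra_of_isAlgebraic hint.isAlgebraic]
    exact hle z.2
  obtain ⟨a, b, hab⟩ := exists_of_mem_adjoin hr' hz
  exact ⟨a, b, Subtype.ext hab⟩

theorem exists_sqrt_sqrtField [IsAlgClosure F Ω] (s : Fˣ) :
    ∃ r : sqrtField Ω s, r ^ 2 = algebraMap F (sqrtField Ω s) s := by
  have := IsAlgClosure.isAlgClosed F (K := Ω)
  obtain ⟨r, hr⟩ := IsAlgClosed.exists_pow_nat_eq (algebraMap F Ω s) two_pos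
  exact ⟨⟨r, subset_adjoin F _ hr⟩, Subtype.ext hr⟩

theorem IsRepSet.not_isSquare (hS : IsRepSet S) {s : Fˣ} (hs : s ∈ S) : ¬ IsSquare (s : F) := by
  rw [← sq_eq_one_iff]
  exact hS.mapsTo hs

/-- The extension `L` is generated by a root of the quartic attached to a representative of the
parameter: a square root of `α = a + b √s` is a sum of two roots of `X ^ 4 - a X ^ 2 + b ^ 2 s / 4`
and `√a + √b` is a root of `X ^ 4 - 2 (a + b) X ^ 2 + (a - b) ^ 2`. -/
def Corresponds (L : NonCyclicExt F) : Param Ω S → Prop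
  | Sum.inl ⟨s, q⟩ => ∃ (x : L.carrier) (a b : F) (r : sqrtField Ω s.1) (α : (sqrtField Ω s.1)ˣ),
      r ^ 2 = algebraMap F (sqrtField Ω s.1) (s.1 : F) ∧
      IsGenWithMinpoly F L.carrier x (-a) (b ^ 2 * (s.1 : F) / 4) ∧
      (α : sqrtField Ω s.1) = algebraMap F (sqrtField Ω s.1) a +
        algebraMap F (sqrtField Ω s.1) b * r ∧ q.1 = galOrbit F α
  | Sum.inr q => ∃ (x : L.carrier) (a b : Fˣ),
      IsGenWithMinpoly F L.carrier x (-2 * ((a : F) + b)) (((a : F) - b) ^ 2) ∧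
      q.1 = elemOrbit a b

theorem Corresponds.not_isGalois (h2 : (2 : F) ≠ 0) (hS : IsRepSet S) {L : NonCyclicExt F}
    {q : Σ s : S, NonGaloisParam F (sqrtField Ω s.1)}
    (h : Corresponds L (Sum.inl q : Param Ω S)) : ¬ IsGalois F L.carrier := by
  obtain ⟨x, a, b, r, α, hr, hx, -⟩ := h
  exact (isQuadraticGen_sqrtField (hS.not_isSquare q.1.2) hr).not_isGalois h2 hx L.not_cyclic

theorem Corresponds.isElementaryAbelianQuartic (h2 : (2 : F) ≠ 0) {L : NonCyclicExt F}
    {q : ElemParam F} (h : Corresponds L (Sum.inr q : Param Ω S)) :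
    IsElementaryAbelianQuartic F L.carrier := by
  obtain ⟨x, a, b, hx, -⟩ := h
  exact hx.isElementaryAbelianQuartic h2 ⟨_, pow_two _⟩

theorem exists_corresponds_inl (h2 : (2 : F) ≠ 0) (hS : IsRepSet S) (L : NonCyclicExt F)
    {x : L.carrier} {s : S} {a b : F} {r : sqrtField Ω s.1}
    (hr : r ^ 2 = algebraMap F (sqrtField Ω s.1) (s.1 : F))
    (hx : IsGenWithMinpoly F L.carrier x (-a) (b ^ 2 * (s.1 : F) / 4)) :
    ∃ (α : (sqrtField Ω s.1)ˣ) (q : NonGaloisParam F (sqrtField Ω s.1)),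
      (α : sqrtField Ω s.1) = algebraMap F (sqrtField Ω s.1) a +
        algebraMap F (sqrtField Ω s.1) b * r ∧ q.1 = galOrbit F α ∧
      Corresponds L (Sum.inl ⟨s, q⟩ : Param Ω S) := by
  obtain ⟨α, hα, hN⟩ := (isQuadraticGen_sqrtField (hS.not_isSquare s.2) hr).exists_unit h2 hx
    L.not_cyclic
  exact ⟨α, ⟨galOrbit F α, α, hN, rfl⟩, hα, rfl, x, a, b, r, α, hr, hx, hα, rfl⟩

theorem exists_corresponds_inr (h2 : (2 : F) ≠ 0) (L : NonCyclicExt F)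
    {x : L.carrier} {a b : Fˣ}
    (hx : IsGenWithMinpoly F L.carrier x (-2 * ((a : F) + b)) (((a : F) - b) ^ 2)) :
    ∃ q : ElemParam F, q.1 = elemOrbit a b ∧ Corresponds L (Sum.inr q : Param Ω S) :=
  ⟨⟨elemOrbit a b, orbit_avoids_iff.2 (triple_sq_ne_one h2 hx)⟩, rfl, x, a, b, hx, rfl⟩

theorem exists_corresponds [IsAlgClosure F Ω] (h2 : (2 : F) ≠ 0) (hS : IsRepSet S)
    (L : NonCyclicExt F) : ∃ p : Param Ω S, Corresponds L p := by
  obtain ⟨x, c, d, hx⟩ := L.biquadratic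
  by_cases hd : IsSquare d
  · obtain ⟨a, b, hx'⟩ := hx.exists_units h2 hd
    obtain ⟨q, -, hq⟩ := exists_corresponds_inr (Ω := Ω) (S := S) h2 L hx'
    exact ⟨_, hq⟩
  · have h4 := four_ne_zero_of_two h2
    obtain ⟨s, hs, hsd⟩ := hS.surjOn (a := sq (Units.mk0 d hx.const_ne_zero))
      (fun h => hd (sq_eq_one_iff.1 h))
    obtain ⟨e, he⟩ := sq_eq_sq_iff.1 hsd.symm
    obtain ⟨r, hr⟩ := exists_sqrt_sqrtField (Ω := Ω) s
    have hx' : IsGenWithMinpoly F L.carrier x (-(-c)) ((2 * e) ^ 2 * (s : F) / 4) := by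
      rw [neg_neg, show (2 * e) ^ 2 * (s : F) / 4 = d by
        rw [show d = s * e ^ 2 from he]; field_simp; ring]
      exact hx
    obtain ⟨-, q, -, -, hq⟩ := exists_corresponds_inl (s := ⟨s, hs⟩) h2 hS L hr hx'
    exact ⟨_, hq⟩

theorem exists_corresponds_ext [IsAlgClosure F Ω] (h2 : (2 : F) ≠ 0) (hS : IsRepSet S)
    (p : Param Ω S) : ∃ L : NonCyclicExt F, Corresponds L p := by
  rcases p with ⟨s, q, α, hN, rfl⟩ | ⟨q, hq⟩
  · obtain ⟨r, hr⟩ := exists_sqrt_sqrtField (Ω := Ω) s.1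
    have hE := isQuadraticGen_sqrtField (hS.not_isSquare s.2) hr
    obtain ⟨a, b, hα⟩ := hE.exists_coord α
    have : Fact (Irreducible (X ^ 4 + C (-a) * X ^ 2 + C (b ^ 2 * (s.1 : F) / 4) : F[X])) :=
      ⟨hE.irreducible h2 hα hN⟩
    have hgen := isGenWithMinpoly_adjoinRoot (c := -a) (d := b ^ 2 * (s.1 : F) / 4)
    exact ⟨⟨AdjoinRoot _, ⟨_, _, _, hgen⟩, hE.not_isCyclicQuartic h2 hα hN hgen⟩,
      _, a, b, r, α, hr, hgen, hα, rfl⟩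
  · induction q using Quotient.inductionOn with | h p => ?_
    obtain ⟨x, y⟩ := p
    induction x using QuotientGroup.induction_on with | H a => ?_
    induction y using QuotientGroup.induction_on with | H b => ?_
    obtain ⟨ha, hb, hab⟩ := forall_triple_ne_one_iff.1 (orbit_avoids_iff.1 hq)
    have : Fact (Irreducible (X ^ 4 + C (-2 * ((a : F) + b)) * X ^ 2 +
        C (((a : F) - b) ^ 2) : F[X])) := ⟨irreducible_of_not_isSquare h2 ha hb hab⟩
    have hgen := isGenWithMinpoly_adjoinRoot (c := -2 * ((a : F) + b)) (d := ((a : F) - b) ^ 2)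
    exact ⟨⟨AdjoinRoot _, ⟨_, _, _, hgen⟩,
      (hgen.isElementaryAbelianQuartic h2 ⟨_, pow_two _⟩).not_isCyclicQuartic⟩,
      _, a, b, hgen, rfl⟩

theorem Corresponds.map {L L' : NonCyclicExt F} (e : L.carrier ≃ₐ[F] L'.carrier) {p : Param Ω S}
    (h : Corresponds L p) : Corresponds L' p := by
  rcases p with ⟨s, q⟩ | q
  · obtain ⟨x, a, b, r, α, hr, hx, h⟩ := h
    exact ⟨e x, a, b, r, α, hr, hx.map e, h⟩
  · obtain ⟨x, a, b, hx, h⟩ := h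
    exact ⟨e x, a, b, hx.map e, h⟩

/-- Any two square roots of `s` lead to the same expressions `a ± b √s`. -/
theorem exists_coord_eq {s : F} {E : Type*} [Field E] [Algebra F E] {r r' z : E}
    (hr : r ^ 2 = algebraMap F E s) (hr' : r' ^ 2 = algebraMap F E s) {a b : F}
    (hz : z = algebraMap F E a + algebraMap F E b * r') :
    ∃ b' : F, b' ^ 2 = b ^ 2 ∧ z = algebraMap F E a + algebraMap F E b' * r := by
  rcases sq_eq_sq_iff_eq_or_eq_neg.1 (hr'.trans hr.symm) with rfl | rfl
  · exact ⟨b, rfl, hz⟩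
  · exact ⟨-b, neg_sq b, by rw [hz, map_neg]; ring⟩

theorem Corresponds.unique (h2 : (2 : F) ≠ 0) (hS : IsRepSet S) {L : NonCyclicExt F}
    {p p' : Param Ω S} (h : Corresponds L p) (h' : Corresponds L p') : p = p' := by
  rcases p with q | q <;> rcases p' with q' | q'
  · obtain ⟨s, q⟩ := q
    obtain ⟨s', q'⟩ := q'
    obtain ⟨x, a, b, r, α, hr, hx, hα, hq⟩ := h
    obtain ⟨y, a', b', r', α', hr', hy, hα', hq'⟩ := h'
    have hE := isQuadraticGen_sqrtField (hS.not_isSquare s.2) hr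
    have hss := hE.isSquare_mul_of_gen h2 hx hy
    rw [← Units.val_mul, ← sq_eq_one_iff] at hss
    obtain rfl : s' = s := Subtype.ext (hS.injOn s'.2 s.2 (SqClass.eq_of_mul_eq_one hss))
    obtain ⟨b'', hb, hα''⟩ := exists_coord_eq hr hr' hα'
    rw [← hb] at hy
    obtain rfl : q = q' :=
      Subtype.ext (hq.trans ((hE.galOrbit_eq_of_gen h2 hx hy hα hα'').symm.trans hq'.symm))
    rfl
  · exact absurd (h'.isElementaryAbelianQuartic h2).1 (h.not_isGalois h2 hS)
  · exact absurd (h.isElementaryAbelianQuartic h2).1 (h'.not_isGalois h2 hS)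
  · obtain ⟨x, a, b, hx, hq⟩ := h
    obtain ⟨y, a', b', hy, hq'⟩ := h'
    exact congrArg Sum.inr (Subtype.ext (hq.trans ((elemOrbit_eq_of_gen h2 hx hy).trans hq'.symm)))

theorem Corresponds.nonempty_algEquiv (h2 : (2 : F) ≠ 0) (hS : IsRepSet S) {L L' : NonCyclicExt F}
    {p : Param Ω S} (h : Corresponds L p) (h' : Corresponds L' p) :
    Nonempty (L.carrier ≃ₐ[F] L'.carrier) := by
  rcases p with ⟨s, q⟩ | q
  · obtain ⟨x, a, b, r, α, hr, hx, hα, hq⟩ := h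
    obtain ⟨y, a', b', r', α', hr', hy, hα', hq'⟩ := h'
    obtain ⟨b'', hb, hα''⟩ := exists_coord_eq hr hr' hα'
    rw [← hb] at hy
    exact (isQuadraticGen_sqrtField (hS.not_isSquare s.2) hr).nonempty_algEquiv_of_galOrbit_eq h2
      hx hy hα hα'' (hq'.symm.trans hq)
  · obtain ⟨x, a, b, hx, hq⟩ := h
    obtain ⟨y, a', b', hy, hq'⟩ := h'
    exact nonempty_algEquiv_of_elemOrbit_eq h2 hx hy (hq.symm.trans hq')

/-- The bijection given by the relation `Corresponds`. -/
theorem exists_equiv_corresponds [IsAlgClosure F Ω] (h2 : (2 : F) ≠ 0) (hS : IsRepSet S) :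
    ∃ ψ : IsoClasses F ≃ Param Ω S, ∀ L p, ψ ⟦L⟧ = p ↔ Corresponds L p := by
  choose f hf using exists_corresponds (Ω := Ω) h2 hS
  have hlift : ∀ L L' : NonCyclicExt F, L ≈ L' → f L = f L' := by
    rintro L L' ⟨e⟩
    exact ((hf L).map e).unique h2 hS (hf L')
  refine ⟨Equiv.ofBijective (Quotient.lift f hlift) ⟨?_, ?_⟩, fun L p => ⟨?_, ?_⟩⟩
  · rintro ⟨L⟩ ⟨L'⟩ h
    have h' : f L = f L' := h
    refine Quotient.sound ((hf L).nonempty_algEquiv h2 hS ?_)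
    rw [h']
    exact hf L'
  · intro p
    obtain ⟨L, hL⟩ := exists_corresponds_ext h2 hS p
    exact ⟨⟦L⟧, (hf L).unique h2 hS hL⟩
  · rintro rfl
    exact hf L
  · exact (hf L).unique h2 hS

end Classification

/-! ### Pairs over a field that descend to a subfield -/

section Descent

variable {F : Type u} [Field F] {C : Type v} [Field C] [Algebra F C]

theorem triple_map {M N : Type*} [MulOneClass M] [MulOneClass N] (g : M →* N) (p : M × M)
    (i : Fin 3) : triple (g p.1, g p.2) i = g (triple p i) := by
  fin_cases i
  · rfl
  · rfl
  · exact (map_mul g p.1 p.2).symm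

theorem permPair_map {M N : Type*} [MulOneClass M] [MulOneClass N] (g : M →* N)
    (τ : Equiv.Perm (Fin 3)) (p : M × M) :
    permPair τ (g p.1, g p.2) = (g (permPair τ p).1, g (permPair τ p).2) :=
  Prod.ext (triple_map g p _) (triple_map g p _)

theorem permPair_sq {K : Type w} [Field K] (τ : Equiv.Perm (Fin 3)) (p : Kˣ × Kˣ) :
    permPair τ (sq p.1, sq p.2) = (sq (permPair τ p).1, sq (permPair τ p).2) :=
  Prod.ext (triple_sq p.1 p.2 _) (triple_sq p.1 p.2 _)

/-- If two entries of the triple `(b, b', b b')` lie in a subgroup, so do `b` and `b'`. -/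
theorem mem_of_triple_mem {M : Type*} [Group M] {H : Subgroup M} {p : M × M} {i k : Fin 3}
    (hik : i ≠ k) (hi : triple p i ∈ H) (hk : triple p k ∈ H) : p.1 ∈ H ∧ p.2 ∈ H := by
  have h01 : p.1 ∈ H → p.1 * p.2 ∈ H → p.1 ∈ H ∧ p.2 ∈ H :=
    fun h h' => ⟨h, (H.mul_mem_cancel_left h).1 h'⟩
  have h12 : p.2 ∈ H → p.1 * p.2 ∈ H → p.1 ∈ H ∧ p.2 ∈ H :=
    fun h h' => ⟨(H.mul_mem_cancel_right h).1 h', h⟩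
  fin_cases i <;> fin_cases k
  · exact absurd rfl hik
  · exact ⟨hi, hk⟩
  · exact h01 hi hk
  · exact ⟨hk, hi⟩
  · exact absurd rfl hik
  · exact h12 hi hk
  · exact h01 hk hi
  · exact h12 hk hi
  · exact absurd rfl hik

variable {K : Type w} [Field K] [Algebra F K]

/-- For a pair of elements of `Cˣ` that comes from a pair of elements of `Kˣ`, the `S₃`-orbit of
the square classes of the latter; the empty set for all other pairs. -/
def pairOrbits (j : K →ₐ[F] C) (x : Cˣ × Cˣ) :
    Set (MulAction.orbitRel.Quotient (Equiv.Perm (Fin 3)) (SqClass K × SqClass K)) :=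
  {o | ∃ P Q : Kˣ, (x.1 : C) = j P ∧ (x.2 : C) = j Q ∧ o = Quotient.mk _ (sq P, sq Q)}

theorem pairOrbits_subset_of_q2Rel (j : K →ₐ[F] C) {x y : Cˣ × Cˣ} (h : Q2Rel F C x y) :
    pairOrbits j x ⊆ pairOrbits j y := by
  have hj : Function.Injective j := j.injective
  rintro o ⟨P, Q, hP, hQ, rfl⟩
  -- It suffices to lift `y` to a pair with the same square classes.
  have key : ∀ p q e f : K, (y.1 : C) = j p → (y.2 : C) = j q → (P : K) = p * e ^ 2 →
      (Q : K) = q * f ^ 2 → Quotient.mk _ (sq P, sq Q) ∈ pairOrbits j y := by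
    intro p q e f hp hq he hf
    have hp0 : p ≠ 0 := by rintro rfl; simp at hp
    have hq0 : q ≠ 0 := by rintro rfl; simp at hq
    refine ⟨Units.mk0 p hp0, Units.mk0 q hq0, hp, hq, ?_⟩
    rw [show sq P = sq (Units.mk0 p hp0) from sq_eq_sq_iff.2 ⟨e, he⟩,
      show sq Q = sq (Units.mk0 q hq0) from sq_eq_sq_iff.2 ⟨f, hf⟩]
  rcases h with rfl | ⟨a, a', b, b', rfl, rfl, h, h'⟩ |
    ⟨δ, d, hd, σ, hσ, a, b, ha, hb, h1, h2, h3, h4, h⟩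
  · exact ⟨P, Q, hP, hQ, rfl⟩
  · obtain ⟨e, he⟩ := h
    obtain ⟨f, hf⟩ := h'
    rw [div_eq_iff_eq_mul] at he hf
    refine key (algebraMap F K b) (algebraMap F K b') (algebraMap F K e) (algebraMap F K f)
      (j.commutes _).symm (j.commutes _).symm (hj ?_) (hj ?_)
    · rw [← hP, ← map_pow, ← map_mul, j.commutes]
      change algebraMap F C a = _
      rw [he, Units.val_mul, Units.val_mul]
      ring_nf
    · rw [← hQ, ← map_pow, ← map_mul, j.commutes]
      change algebraMap F C a' = _
      rw [hf, Units.val_mul, Units.val_mul]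
      ring_nf
  · -- The field `F(δ) = F(a)` is contained in the image of `K`.
    have hle : F⟮δ⟯ ≤ j.fieldRange := by
      rw [adjoin_eq_of_notMem hd _ ha, adjoin_simple_le_iff, ← h1, hP]
      exact ⟨P, rfl⟩
    obtain ⟨e, he⟩ := h
    rw [div_eq_iff_eq_mul] at he
    have he1 : (a : F⟮δ⟯) = b * (e : F⟮δ⟯) ^ 2 := by
      rw [he, Units.val_mul, Units.val_mul]
      ring
    obtain ⟨p, hp⟩ := hle (b : F⟮δ⟯).2
    obtain ⟨q, hq⟩ := hle (σ b).2
    obtain ⟨f, hf⟩ := hle (e : F⟮δ⟯).2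
    obtain ⟨g, hg⟩ := hle (σ e).2
    have hp' : j p = (b : F⟮δ⟯) := hp
    have hq' : j q = σ b := hq
    have hf' : j f = (e : F⟮δ⟯) := hf
    have hg' : j g = σ e := hg
    refine key p q f g (h3.trans hp.symm) (h4.trans hq.symm) (hj ?_) (hj ?_)
    · rw [← hP, h1, map_mul, map_pow, hp', hf', he1]
      rfl
    · rw [← hQ, h2, map_mul, map_pow, hq', hg', he1, map_mul, map_pow]
      rfl

theorem pairOrbits_permPair (j : K →ₐ[F] C) (τ : Equiv.Perm (Fin 3)) (x : Cˣ × Cˣ) :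
    pairOrbits j (permPair τ x) = pairOrbits j x := by
  let g : Kˣ →* Cˣ := Units.map (j : K →* C)
  have hg : Function.Injective g := Units.map_injective j.injective
  ext o
  constructor
  · rintro ⟨P, Q, hP, hQ, rfl⟩
    have hP' : triple x (τ 0) = g P := Units.ext hP
    have hQ' : triple x (τ 1) = g Q := Units.ext hQ
    obtain ⟨⟨P₀, hP₀⟩, ⟨Q₀, hQ₀⟩⟩ := mem_of_triple_mem (H := g.range) (p := x)
      (i := τ 0) (k := τ 1) (fun h => by simpa using τ.injective h) ⟨P, hP'.symm⟩ ⟨Q, hQ'.symm⟩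
    refine ⟨P₀, Q₀, (congrArg Units.val hP₀).symm, (congrArg Units.val hQ₀).symm, ?_⟩
    refine orbit_eq_iff.2 ⟨τ, ?_⟩
    have hx : x = (g (P₀, Q₀).1, g (P₀, Q₀).2) := Prod.ext hP₀.symm hQ₀.symm
    have hPQ : (g P, g Q) = permPair τ x := Prod.ext hP'.symm hQ'.symm
    rw [hx, permPair_map] at hPQ
    rw [permPair_sq τ (P₀, Q₀), ← hg (congrArg Prod.fst hPQ), ← hg (congrArg Prod.snd hPQ)]
  · rintro ⟨P, Q, hP, hQ, rfl⟩
    have hx : x = (g (P, Q).1, g (P, Q).2) := Prod.ext (Units.ext hP) (Units.ext hQ)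
    refine ⟨(permPair τ (P, Q)).1, (permPair τ (P, Q)).2, ?_, ?_, ?_⟩
    · rw [hx, permPair_map]
      rfl
    · rw [hx, permPair_map]
      rfl
    · rw [← permPair_sq τ (P, Q)]
      exact (orbit_eq_iff.2 ⟨τ, rfl⟩).symm

/-- The invariant `pairOrbits` on the quotient of `Cˣ × Cˣ`. It is well defined since a field `F(δ)`
is generated by any of its elements outside `F`, and since any two entries of `(b, b', b b')`
generate the same group. -/
def descentOrbits (j : K →ₐ[F] C) : Q2S3Quot F C →
    Set (MulAction.orbitRel.Quotient (Equiv.Perm (Fin 3)) (SqClass K × SqClass K)) :=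
  Quot.lift (Quotient.lift (s := q2Setoid F C) (pairOrbits j) fun _ _ h =>
    (pairOrbits_subset_of_q2Rel j h).antisymm
      (pairOrbits_subset_of_q2Rel j ((q2Rel_equivalence F C).symm h))) (by
    rintro _ _ ⟨τ, p, rfl, rfl⟩
    exact (pairOrbits_permPair j τ p).symm)

theorem mem_descentOrbits (j : K →ₐ[F] C) {a b : Cˣ} {P Q : Kˣ} (ha : (a : C) = j P)
    (hb : (b : C) = j Q) :
    (Quotient.mk _ (sq P, sq Q) : MulAction.orbitRel.Quotient (Equiv.Perm (Fin 3))
      (SqClass K × SqClass K)) ∈ descentOrbits j (q2Class F a b) :=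
  ⟨P, Q, ha, hb, rfl⟩

theorem exists_of_mem_descentOrbits (j : K →ₐ[F] C) {a b : Cˣ}
    {o : MulAction.orbitRel.Quotient (Equiv.Perm (Fin 3)) (SqClass K × SqClass K)}
    (h : o ∈ descentOrbits j (q2Class F a b)) :
    ∃ P Q : Kˣ, (a : C) = j P ∧ (b : C) = j Q ∧ o = Quotient.mk _ (sq P, sq Q) := h

theorem q2Class_permPair (τ : Equiv.Perm (Fin 3)) (p : Cˣ × Cˣ) :
    q2Class F (permPair τ p).1 (permPair τ p).2 = q2Class F p.1 p.2 :=
  (Quot.sound ⟨τ, p, rfl, rfl⟩).symm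

theorem q2Class_swap (a b : Cˣ) : q2Class F a b = q2Class F b a :=
  q2Class_permPair (Equiv.swap 0 1) (b, a)

theorem q2Class_eq_of_q2Rel {a b a' b' : Cˣ} (h : Q2Rel F C (a, b) (a', b')) :
    q2Class F a b = q2Class F a' b' :=
  congrArg (Quot.mk _) (Quotient.sound (s := q2Setoid F C) h)

theorem q2Class_eq_of_elemOrbit_eq {a b a' b' : Fˣ} (h : elemOrbit a b = elemOrbit a' b') :
    q2Class F (Units.map (algebraMap F C : F →* C) a) (Units.map (algebraMap F C : F →* C) b) =
      q2Class F (Units.map (algebraMap F C : F →* C) a')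
        (Units.map (algebraMap F C : F →* C) b') := by
  obtain ⟨τ, hτ⟩ := orbit_eq_iff.1 h
  rw [permPair_sq τ (a', b')] at hτ
  rw [← q2Class_permPair τ (Units.map (algebraMap F C : F →* C) a', _),
    permPair_map (Units.map (algebraMap F C : F →* C)) τ (a', b')]
  have hsq : ∀ {x y : Fˣ}, sq x = sq y → IsSquare (x / y) := by
    intro x y hxy
    obtain ⟨e, he⟩ := QuotientGroup.eq.1 hxy.symm
    exact ⟨e, by rw [div_eq_inv_mul, ← he, ← pow_two]; rfl⟩
  exact q2Class_eq_of_q2Rel (Or.inr (Or.inl ⟨_, _, _, _, rfl, rfl,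
    hsq (congrArg Prod.fst hτ).symm, hsq (congrArg Prod.snd hτ).symm⟩))

end Descent

/-! ### Conjugate pairs -/

section Conjugate

variable {F : Type u} [Field F] {C : Type v} [Field C] [Algebra F C] {E : Type w} [Field E]
  [Algebra F E] {s : F} {r : E}

namespace IsQuadraticGen

theorem map (h : IsQuadraticGen s r) {E' : Type*} [Field E'] [Algebra F E'] (e : E ≃ₐ[F] E') :
    IsQuadraticGen s (e r) := by
  refine ⟨by rw [← map_pow, h.sq_eq, AlgEquiv.commutes], h.not_isSquare, fun z => ?_⟩
  obtain ⟨a, b, hab⟩ := h.exists_coord (e.symm z)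
  refine ⟨a, b, ?_⟩
  rw [← e.apply_symm_apply z, hab]
  simp

theorem notMem_range_of_notMem_normSquare (h : IsQuadraticGen s r) (h2 : (2 : F) ≠ 0) {α : Eˣ}
    (hN : α ∉ normSquare F E) : (α : E) ∉ (algebraMap F E).range := by
  rintro ⟨a, ha⟩
  exact h.coord_ne_zero_of_not_mem h2 (a := a) (b := 0) (by rw [← ha]; simp) hN rfl

theorem conj_conj (h : IsQuadraticGen s r) {σ : E ≃ₐ[F] E} (hσ : σ r = -r) (z : E) :
    σ (σ z) = z := by
  have : σ * σ = 1 := h.algEquiv_ext (by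
    change σ (σ r) = r
    rw [hσ, map_neg, hσ, neg_neg])
  exact DFunLike.congr_fun this z

/-- The set `normSquare F E` is a union of Galois orbits of square classes. -/
theorem mem_normSquare_of_galOrbit_eq (h : IsQuadraticGen s r) (h2 : (2 : F) ≠ 0) {α β : Eˣ}
    (hα : α ∈ normSquare F E) (heq : galOrbit F α = galOrbit F β) : β ∈ normSquare F E := by
  obtain ⟨σ, hσ⟩ := h.exists_conj
  rw [h.mem_normSquare_iff_isSquare h2 hσ] at hα ⊢
  have h1 : ∃ e : E, (β : E) * σ β = α * σ α * e ^ 2 := by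
    rcases (h.galOrbit_eq_iff hσ).1 heq.symm with h1 | h1
    · obtain ⟨e, he⟩ := sq_eq_sq_iff.1 h1
      exact ⟨e * σ e, by rw [he, map_mul, map_pow]; ring⟩
    · obtain ⟨e, he⟩ := sq_eq_sq_iff.1 h1
      have he' : (β : E) = σ α * e ^ 2 := he
      exact ⟨e * σ e, by rw [he', map_mul, map_pow, h.conj_conj hσ]; ring⟩
  obtain ⟨e, he⟩ := h1
  rw [he]
  exact hα.mul ⟨e, pow_two e⟩

/-- In the orbit of the square classes of `(α, σ(α))` the entry `α σ(α)` is the only one that is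
fixed by `σ`, so the orbit determines the conjugates `α` and `σ(α)` up to squares. -/
theorem galOrbit_eq_of_orbit_eq (h : IsQuadraticGen s r) (h2 : (2 : F) ≠ 0) {σ : E ≃ₐ[F] E}
    (hσ : σ r = -r) {α β : Eˣ} (hα : α ∉ normSquare F E)
    (heq : (Quotient.mk _ (sq α, sq (Units.map (σ : E →* E) α)) :
      MulAction.orbitRel.Quotient (Equiv.Perm (Fin 3)) (SqClass E × SqClass E)) =
      Quotient.mk _ (sq β, sq (Units.map (σ : E →* E) β))) : galOrbit F α = galOrbit F β := by
  rw [h.galOrbit_eq_iff hσ]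
  obtain ⟨i, hi⟩ := exists_triple_eq_of_orbit_eq heq 0
  have h3 : sq α ≠ sq (β * Units.map (σ : E →* E) β) := by
    intro h3
    obtain ⟨e, he⟩ := sq_eq_sq_iff.1 h3
    have he' : (α : E) = β * σ β * e ^ 2 := he
    refine hα ((h.mem_normSquare_iff_isSquare h2 hσ).2 ⟨β * σ β * e * σ e, ?_⟩)
    rw [he', map_mul, map_mul, map_pow, h.conj_conj hσ]
    ring
  fin_cases i
  · exact Or.inl hi
  · exact Or.inr hi
  · exact absurd hi h3

variable (j : E →ₐ[F] C)

theorem q2Class_eq_of_sq_eq (h : IsQuadraticGen s r) (h2 : (2 : F) ≠ 0) {σ : E ≃ₐ[F] E}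
    (hσ : σ r = -r) {α β : Eˣ} (hα : α ∉ normSquare F E) (hβ : β ∉ normSquare F E)
    (heq : sq α = sq β) {a a' b b' : Cˣ} (ha : (a : C) = j α) (ha' : (a' : C) = j (σ α))
    (hb : (b : C) = j β) (hb' : (b' : C) = j (σ β)) : q2Class F a a' = q2Class F b b' := by
  have hrange : j.fieldRange = F⟮j r⟯ := by
    refine le_antisymm ?_ (adjoin_simple_le_iff.2 ⟨r, rfl⟩)
    rintro _ ⟨z, rfl⟩
    obtain ⟨k, l, rfl⟩ := h.exists_coord z
    change j _ ∈ _
    rw [map_add, map_mul, j.commutes, j.commutes]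
    exact add_mem (F⟮j r⟯.algebraMap_mem k)
      (mul_mem (F⟮j r⟯.algebraMap_mem l) (mem_adjoin_simple_self F _))
  let e : E ≃ₐ[F] F⟮j r⟯ := (AlgEquiv.ofInjectiveField j).trans (equivOfEq hrange)
  have he : ∀ z, (e z : C) = j z := fun z => rfl
  have hE := h.map e
  have hnot : ∀ {γ : Eˣ}, γ ∉ normSquare F E → (Units.map (e : E →* F⟮j r⟯) γ : F⟮j r⟯) ∉
      (algebraMap F F⟮j r⟯).range := by
    rintro γ hγ ⟨k, hk⟩
    refine h.notMem_range_of_notMem_normSquare h2 hγ ⟨k, ?_⟩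
    apply e.injective
    rw [e.commutes]
    exact hk
  refine q2Class_eq_of_q2Rel (Or.inr (Or.inr ⟨j r, Units.mk0 s h.base_ne_zero,
    by rw [← map_pow, h.sq_eq, j.commutes]; rfl, e.symm.trans (σ.trans e), ?_,
    Units.map (e : E →* F⟮j r⟯) α, Units.map (e : E →* F⟮j r⟯) β, hnot hα, hnot hβ,
    ha, ?_, hb, ?_, ?_⟩))
  · rw [hE.zpowers_eq_top_iff h2]
    change e (σ (e.symm (e r))) = _
    rw [e.symm_apply_apply, hσ, map_neg]
  · change (a' : C) = e (σ (e.symm (e α)))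
    rw [e.symm_apply_apply, he, ha']
  · change (b' : C) = e (σ (e.symm (e β)))
    rw [e.symm_apply_apply, he, hb']
  · obtain ⟨k, hk⟩ := QuotientGroup.eq.1 heq.symm
    rw [← _root_.map_div]
    refine IsSquare.map (Units.map (e : E →* F⟮j r⟯)) ⟨k, ?_⟩
    rw [div_eq_inv_mul, ← hk, ← pow_two]
    rfl

theorem q2Class_eq_of_galOrbit_eq (h : IsQuadraticGen s r) (h2 : (2 : F) ≠ 0) {σ : E ≃ₐ[F] E}
    (hσ : σ r = -r) {α β : Eˣ} (hα : α ∉ normSquare F E)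
    (heq : galOrbit F α = galOrbit F β) {a a' b b' : Cˣ} (ha : (a : C) = j α)
    (ha' : (a' : C) = j (σ α)) (hb : (b : C) = j β) (hb' : (b' : C) = j (σ β)) :
    q2Class F a a' = q2Class F b b' := by
  have hβ : β ∉ normSquare F E := fun hβ => hα (h.mem_normSquare_of_galOrbit_eq h2 hβ heq.symm)
  rcases (h.galOrbit_eq_iff hσ).1 heq with h1 | h1
  · exact h.q2Class_eq_of_sq_eq j h2 hσ hα hβ h1 ha ha' hb hb'
  · have hσβ : Units.map (σ : E →* E) β ∉ normSquare F E := fun hβ' =>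
      hβ (h.mem_normSquare_of_galOrbit_eq h2 hβ' ((h.galOrbit_eq_iff hσ).2 (Or.inr rfl)))
    rw [q2Class_swap b b']
    refine h.q2Class_eq_of_sq_eq j h2 hσ hα hσβ h1 ha ha' hb' ?_
    rw [hb]
    exact congrArg j (h.conj_conj hσ β).symm

end IsQuadraticGen

end Conjugate

/-! ### The embedding of the parameters -/

section Embedding

variable {F : Type u} [Field F] {Ω : Type v} [Field Ω] [Algebra F Ω] {S : Set Fˣ}

theorem IsQuadraticGen.sqrtField_le {s : Fˣ} {r : sqrtField Ω s}
    (h : IsQuadraticGen (s : F) r) : sqrtField Ω s ≤ quadCompositum F Ω :=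
  le_iSup₂_of_le (sqrtField Ω s) h.finrank le_rfl

theorem IsQuadraticGen.exists_inclusion {s : Fˣ} {r : sqrtField Ω s}
    (h : IsQuadraticGen (s : F) r) :
    ∃ j : sqrtField Ω s →ₐ[F] quadCompositum F Ω, ∀ z, ((j z : quadCompositum F Ω) : Ω) = z :=
  ⟨inclusion h.sqrtField_le, coe_inclusion h.sqrtField_le⟩

/-- If an element of `F(√s')` outside `F` lies in `F(√s)`, then `s` and `s'` are in the same square
class. -/
theorem isSquare_mul_of_mem_sqrtField (h2 : (2 : F) ≠ 0) {s s' : Fˣ} {r : sqrtField Ω s}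
    (h : IsQuadraticGen (s : F) r) {r' : sqrtField Ω s'} (h' : IsQuadraticGen (s' : F) r')
    {α : sqrtField Ω s'} (hα : α ∉ (algebraMap F (sqrtField Ω s')).range)
    (hmem : (α : Ω) ∈ sqrtField Ω s) : IsSquare ((s' : F) * s) := by
  obtain ⟨a, b, rfl⟩ := h'.exists_coord α
  have hb : b ≠ 0 := by
    rintro rfl
    exact hα ⟨a, by simp⟩
  have hr' : (r' : Ω) ∈ sqrtField Ω s := by
    have hb' : algebraMap F Ω b ≠ 0 := (_root_.map_ne_zero _).2 hb
    have h1 : (r' : Ω) = (algebraMap F Ω a + algebraMap F Ω b * r' - algebraMap F Ω a) *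
        algebraMap F Ω b⁻¹ := by
      rw [map_inv₀]
      field_simp
      ring
    rw [h1]
    exact mul_mem (sub_mem hmem ((sqrtField Ω s).algebraMap_mem _))
      ((sqrtField Ω s).algebraMap_mem _)
  refine ((h.isSquare_algebraMap_iff h2).1 ⟨⟨r', hr'⟩, Subtype.ext ?_⟩).resolve_left
    h'.not_isSquare
  change algebraMap F Ω s' = (r' : Ω) * r'
  rw [← pow_two]
  exact (congrArg Subtype.val h'.sq_eq).symm

theorem exists_elemOrbit_eq (o : MulAction.orbitRel.Quotient (Equiv.Perm (Fin 3))
    (SqClass F × SqClass F)) : ∃ a b : Fˣ, o = elemOrbit a b := by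
  induction o using Quotient.inductionOn with | h p => ?_
  obtain ⟨x, y⟩ := p
  induction x using QuotientGroup.induction_on with | H a => ?_
  induction y using QuotientGroup.induction_on with | H b => ?_
  exact ⟨a, b, rfl⟩

theorem NonGaloisParam.notMem_normSquare (h2 : (2 : F) ≠ 0) {E : Type*} [Field E] [Algebra F E]
    {s : F} {r : E} (h : IsQuadraticGen s r) {q : NonGaloisParam F E} {α : Eˣ}
    (hq : q.1 = galOrbit F α) : α ∉ normSquare F E := by
  obtain ⟨β, hβ, hqβ⟩ := q.2
  exact fun hα => hβ (h.mem_normSquare_of_galOrbit_eq h2 hα (hq.symm.trans hqβ))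

/-- The class in `Q2S3Quot` attached to a parameter: that of `(α, σ(α))` or of `(a, b)`. -/
def ParamClass : Param Ω S → Q2S3Quot F (quadCompositum F Ω) → Prop
  | Sum.inl ⟨s, q⟩, z => ∃ (r : sqrtField Ω s.1) (α : (sqrtField Ω s.1)ˣ)
      (σ : sqrtField Ω s.1 ≃ₐ[F] sqrtField Ω s.1) (c c' : (quadCompositum F Ω)ˣ),
      IsQuadraticGen (s.1 : F) r ∧ σ r = -r ∧ q.1 = galOrbit F α ∧
      ((c : quadCompositum F Ω) : Ω) = (α : sqrtField Ω s.1) ∧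
      ((c' : quadCompositum F Ω) : Ω) = σ α ∧ z = q2Class F c c'
  | Sum.inr q, z => ∃ a b : Fˣ, q.1 = elemOrbit a b ∧
      z = q2Class F
        (Units.map (algebraMap F (quadCompositum F Ω) : F →* quadCompositum F Ω) a)
        (Units.map (algebraMap F (quadCompositum F Ω) : F →* quadCompositum F Ω) b)

theorem exists_paramClass_inl (h2 : (2 : F) ≠ 0) {s : S} {r : sqrtField Ω s.1}
    (h : IsQuadraticGen (s.1 : F) r) {q : NonGaloisParam F (sqrtField Ω s.1)}
    {α : (sqrtField Ω s.1)ˣ} (hq : q.1 = galOrbit F α)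
    {σ : sqrtField Ω s.1 ≃ₐ[F] sqrtField Ω s.1} (hσ : Subgroup.zpowers σ = ⊤) :
    ∃ c c' : (quadCompositum F Ω)ˣ,
      ((c : quadCompositum F Ω) : Ω) = (α : sqrtField Ω s.1) ∧
      ((c' : quadCompositum F Ω) : Ω) = σ α ∧
      ParamClass (Sum.inl ⟨s, q⟩ : Param Ω S) (q2Class F c c') := by
  obtain ⟨j, hj⟩ := h.exists_inclusion
  have hne : ∀ z : sqrtField Ω s.1, z ≠ 0 → j z ≠ 0 :=
    fun z hz => (map_ne_zero_iff j j.injective).2 hz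
  have hc := hj α
  have hc' := hj (σ α)
  exact ⟨Units.mk0 (j α) (hne _ α.ne_zero),
    Units.mk0 (j (σ α)) (hne _ ((map_ne_zero_iff σ σ.injective).2 α.ne_zero)), hc, hc',
    r, α, σ, _, _, h, (h.zpowers_eq_top_iff h2 σ).1 hσ, hq, hc, hc', rfl⟩

theorem exists_paramClass [IsAlgClosure F Ω] (h2 : (2 : F) ≠ 0) (hS : IsRepSet S)
    (p : Param Ω S) : ∃ z, ParamClass p z := by
  rcases p with ⟨s, q, α, hN, hq⟩ | ⟨q, hq⟩
  · obtain ⟨r, hr⟩ := exists_sqrt_sqrtField (Ω := Ω) s.1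
    have h := isQuadraticGen_sqrtField (hS.not_isSquare s.2) hr
    obtain ⟨σ, hσ⟩ := h.exists_conj
    obtain ⟨c, c', -, -, hc⟩ := exists_paramClass_inl h2 h (q := ⟨q, α, hN, hq⟩) hq
      ((h.zpowers_eq_top_iff h2 σ).2 hσ)
    exact ⟨_, hc⟩
  · obtain ⟨a, b, rfl⟩ := exists_elemOrbit_eq q
    exact ⟨_, a, b, rfl, rfl⟩

theorem ParamClass.unique (h2 : (2 : F) ≠ 0) {p : Param Ω S}
    {z z' : Q2S3Quot F (quadCompositum F Ω)} (h : ParamClass p z) (h' : ParamClass p z') :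
    z = z' := by
  rcases p with ⟨s, q⟩ | q
  · obtain ⟨r, α, σ, c, c', hE, hσ, hq, hc, hc', rfl⟩ := h
    obtain ⟨r', β, τ, b, b', hE', hτ, hq', hb, hb', rfl⟩ := h'
    obtain rfl : σ = τ := hE.algEquiv_ext (hσ.trans
      ((hE.zpowers_eq_top_iff h2 τ).1 ((hE'.zpowers_eq_top_iff h2 τ).2 hτ)).symm)
    obtain ⟨j, hj⟩ := hE.exists_inclusion
    exact hE.q2Class_eq_of_galOrbit_eq j h2 hσ
      (NonGaloisParam.notMem_normSquare h2 hE hq) (hq.symm.trans hq')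
      (Subtype.ext (hc.trans (hj _).symm)) (Subtype.ext (hc'.trans (hj _).symm))
      (Subtype.ext (hb.trans (hj _).symm)) (Subtype.ext (hb'.trans (hj _).symm))
  · obtain ⟨a, b, hq, rfl⟩ := h
    obtain ⟨a', b', hq', rfl⟩ := h'
    exact q2Class_eq_of_elemOrbit_eq (hq.symm.trans hq')

/-- A pair `(α, σ(α))` with `α` not in `F` is not equivalent to a pair of elements of `F`. -/
theorem not_paramClass_inl_of_inr (h2 : (2 : F) ≠ 0)
    {q : Σ s : S, NonGaloisParam F (sqrtField Ω s.1)} {q' : ElemParam F}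
    {z : Q2S3Quot F (quadCompositum F Ω)} (h : ParamClass (Sum.inl q : Param Ω S) z)
    (h' : ParamClass (Sum.inr q' : Param Ω S) z) : False := by
  obtain ⟨r, α, σ, c, c', hE, hσ, hq, hc, hc', rfl⟩ := h
  obtain ⟨a, b, -, hz⟩ := h'
  have hmem := mem_descentOrbits (Algebra.ofId F (quadCompositum F Ω))
    (a := Units.map (algebraMap F (quadCompositum F Ω) : F →* quadCompositum F Ω) a)
    (b := Units.map (algebraMap F (quadCompositum F Ω) : F →* quadCompositum F Ω) b)
    (P := a) (Q := b) rfl rfl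
  rw [← hz] at hmem
  obtain ⟨P, Q, hP, -⟩ := exists_of_mem_descentOrbits _ hmem
  refine hE.notMem_range_of_notMem_normSquare h2 (NonGaloisParam.notMem_normSquare h2 hE hq)
    ⟨P, Subtype.ext ?_⟩
  rw [← hc, hP]
  rfl

theorem ParamClass.injective (h2 : (2 : F) ≠ 0) (hS : IsRepSet S) {p p' : Param Ω S}
    {z : Q2S3Quot F (quadCompositum F Ω)} (h : ParamClass p z) (h' : ParamClass p' z) :
    p = p' := by
  rcases p with ⟨s, q⟩ | q <;> rcases p' with ⟨s', q'⟩ | q'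
  · obtain ⟨r, α, σ, c, c', hE, hσ, hq, hc, hc', rfl⟩ := h
    obtain ⟨r', β, τ, b, b', hE', hτ, hq', hb, hb', hz⟩ := h'
    obtain ⟨j, hj⟩ := hE.exists_inclusion
    have hmem := mem_descentOrbits j (a := c) (b := c') (P := α)
      (Q := Units.map (σ : sqrtField Ω s.1 →* sqrtField Ω s.1) α)
      (Subtype.ext (hc.trans (hj _).symm)) (Subtype.ext (hc'.trans (hj _).symm))
    rw [hz] at hmem
    obtain ⟨P, Q, hP, hQ, hPQ⟩ := exists_of_mem_descentOrbits _ hmem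
    have hP' : ((β : sqrtField Ω s'.1) : Ω) = (P : sqrtField Ω s.1) := by
      rw [← hb, hP, hj]
    have hss := isSquare_mul_of_mem_sqrtField h2 hE hE'
      (hE'.notMem_range_of_notMem_normSquare h2 (NonGaloisParam.notMem_normSquare h2 hE' hq'))
      (hP' ▸ (P : sqrtField Ω s.1).2)
    rw [← Units.val_mul, ← sq_eq_one_iff] at hss
    obtain rfl : s' = s := Subtype.ext (hS.injOn s'.2 s.2 (SqClass.eq_of_mul_eq_one hss))
    obtain rfl : σ = τ := hE.algEquiv_ext (hσ.trans
      ((hE.zpowers_eq_top_iff h2 τ).1 ((hE'.zpowers_eq_top_iff h2 τ).2 hτ)).symm)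
    obtain rfl : β = P := Units.ext (Subtype.ext hP')
    obtain rfl : Units.map (σ : sqrtField Ω s'.1 →* sqrtField Ω s'.1) β = Q :=
        Units.ext (Subtype.ext (by
      change ((σ β : sqrtField Ω s'.1) : Ω) = _
      rw [← hb', hQ, hj]))
    obtain rfl : q = q' := Subtype.ext (hq.trans ((hE.galOrbit_eq_of_orbit_eq h2 hσ
      (NonGaloisParam.notMem_normSquare h2 hE hq) hPQ).trans hq'.symm))
    rfl
  · exact (not_paramClass_inl_of_inr h2 h h').elim
  · exact (not_paramClass_inl_of_inr h2 h' h).elim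
  · obtain ⟨a, b, hq, rfl⟩ := h
    obtain ⟨a', b', hq', hz⟩ := h'
    have hmem := mem_descentOrbits (Algebra.ofId F (quadCompositum F Ω))
      (a := Units.map (algebraMap F (quadCompositum F Ω) : F →* quadCompositum F Ω) a)
      (b := Units.map (algebraMap F (quadCompositum F Ω) : F →* quadCompositum F Ω) b)
      (P := a) (Q := b) rfl rfl
    rw [hz] at hmem
    obtain ⟨P, Q, hP, hQ, hPQ⟩ := exists_of_mem_descentOrbits _ hmem
    have hinj := (algebraMap F (quadCompositum F Ω)).injective
    obtain rfl : a' = P := Units.ext (hinj hP)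
    obtain rfl : b' = Q := Units.ext (hinj hQ)
    exact congrArg Sum.inr (Subtype.ext (hq.trans (hPQ.trans hq'.symm)))

theorem exists_embedding [IsAlgClosure F Ω] (h2 : (2 : F) ≠ 0) (hS : IsRepSet S) :
    ∃ ι : Param Ω S → Q2S3Quot F (quadCompositum F Ω), Function.Injective ι ∧
      ∀ p z, ParamClass p z → ι p = z := by
  choose ι hι using exists_paramClass (Ω := Ω) (S := S) h2 hS
  refine ⟨ι, fun p p' h => (hι p).injective h2 hS ?_, fun p z hz => (hι p).unique h2 hz⟩
  rw [h]
  exact hι p'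

end Embedding

end Biquad

theorem mainTheorem1 {F : Type*} [Field F] (hF : ringChar F ≠ 2)
    (Ω : Type*) [Field Ω] [Algebra F Ω] [IsAlgClosure F Ω]
    (S : Set Fˣ) (hS : Biquad.IsRepSet S) :
    Nonempty (Biquad.trivialPairs F ≃* Biquad.SqClass F) ∧
    (∃ ψ : Biquad.IsoClasses F ≃ Biquad.Param Ω S,
      (∀ L : Biquad.NonCyclicExt F,
        (∃ q, ψ ⟦L⟧ = Sum.inl q) ↔ ¬ IsGalois F L.carrier) ∧
      (∀ L : Biquad.NonCyclicExt F,
        (∃ q, ψ ⟦L⟧ = Sum.inr q) ↔ Biquad.IsElementaryAbelianQuartic F L.carrier) ∧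
      (∀ (L : Biquad.NonCyclicExt F) (x : L.carrier) (s : S) (a b : F)
        (r : Biquad.sqrtField Ω s.1),
        r ^ 2 = algebraMap F (Biquad.sqrtField Ω s.1) (s.1 : F) →
        Biquad.IsGenWithMinpoly F L.carrier x (-a) (b ^ 2 * (s.1 : F) / 4) →
        ∃ (α : (Biquad.sqrtField Ω s.1)ˣ)
          (q : Biquad.NonGaloisParam F (Biquad.sqrtField Ω s.1)),
          (α : Biquad.sqrtField Ω s.1) = algebraMap F (Biquad.sqrtField Ω s.1) a +
            algebraMap F (Biquad.sqrtField Ω s.1) b * r ∧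
          q.1 = Biquad.galOrbit F α ∧ ψ ⟦L⟧ = Sum.inl ⟨s, q⟩) ∧
      (∀ (L : Biquad.NonCyclicExt F) (x : L.carrier) (a b : Fˣ),
        Biquad.IsGenWithMinpoly F L.carrier x (-2 * ((a : F) + b)) (((a : F) - b) ^ 2) →
        ∃ q : Biquad.ElemParam F, q.1 = Biquad.elemOrbit a b ∧ ψ ⟦L⟧ = Sum.inr q)) ∧
    (∃ ι : Biquad.Param Ω S → Biquad.Q2S3Quot F (Biquad.quadCompositum F Ω),
      Function.Injective ι ∧
      (∀ (s : S) (q : Biquad.NonGaloisParam F (Biquad.sqrtField Ω s.1))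
        (α : (Biquad.sqrtField Ω s.1)ˣ)
        (σ : Biquad.sqrtField Ω s.1 ≃ₐ[F] Biquad.sqrtField Ω s.1),
        Subgroup.zpowers σ = ⊤ → q.1 = Biquad.galOrbit F α →
        ∃ c c' : (Biquad.quadCompositum F Ω)ˣ,
          ((c : Biquad.quadCompositum F Ω) : Ω) = (α : Biquad.sqrtField Ω s.1) ∧
          ((c' : Biquad.quadCompositum F Ω) : Ω) = σ α ∧
          ι (Sum.inl ⟨s, q⟩) = Biquad.q2Class F c c') ∧
      (∀ (q : Biquad.ElemParam F) (a b : Fˣ), q.1 = Biquad.elemOrbit a b →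
        ι (Sum.inr q) =
          Biquad.q2Class F
            (Units.map (algebraMap F (Biquad.quadCompositum F Ω) :
              F →* Biquad.quadCompositum F Ω) a)
            (Units.map (algebraMap F (Biquad.quadCompositum F Ω) :
              F →* Biquad.quadCompositum F Ω) b))) := by
  have h2 : (2 : F) ≠ 0 := Ring.two_ne_zero hF
  refine ⟨⟨Biquad.trivialPairsEquiv F⟩, ?_, ?_⟩
  · obtain ⟨ψ, hψ⟩ := Biquad.exists_equiv_corresponds (Ω := Ω) h2 hS
    refine ⟨ψ, fun L => ?_, fun L => ?_, fun L x s a b r hr hx => ?_, fun L x a b hx => ?_⟩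
    · constructor
      · rintro ⟨q, hq⟩
        exact ((hψ _ _).1 hq).not_isGalois h2 hS
      · intro hL
        rcases hp : ψ ⟦L⟧ with q | q
        · exact ⟨q, rfl⟩
        · exact absurd (((hψ _ _).1 hp).isElementaryAbelianQuartic h2).1 hL
    · constructor
      · rintro ⟨q, hq⟩
        exact ((hψ _ _).1 hq).isElementaryAbelianQuartic h2
      · intro hL
        rcases hp : ψ ⟦L⟧ with q | q
        · exact absurd hL.1 (((hψ _ _).1 hp).not_isGalois h2 hS)
        · exact ⟨q, rfl⟩
    · obtain ⟨α, q, hα, hq, hc⟩ := Biquad.exists_corresponds_inl h2 hS L hr hx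
      exact ⟨α, q, hα, hq, (hψ _ _).2 hc⟩
    · obtain ⟨q, hq, hc⟩ := Biquad.exists_corresponds_inr (Ω := Ω) (S := S) h2 L hx
      exact ⟨q, hq, (hψ _ _).2 hc⟩
  · obtain ⟨ι, hinj, hι⟩ := Biquad.exists_embedding (Ω := Ω) h2 hS
    refine ⟨ι, hinj, fun s q α σ hσ hq => ?_, fun q a b hq => hι _ _ ⟨a, b, hq, rfl⟩⟩
    obtain ⟨r, hr⟩ := Biquad.exists_sqrt_sqrtField (Ω := Ω) s.1
    obtain ⟨c, c', hc, hc', hcl⟩ := Biquad.exists_paramClass_inl h2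
      (Biquad.isQuadraticGen_sqrtField (hS.not_isSquare s.2) hr) hq hσ
    exact ⟨c, c', hc, hc', hι _ _ hcl⟩
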